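/- **Theorem** (Cappelli–Itzykson–Zuber classification). Fix an integer $n\ge 3$, let $P_+=\{1,2,\dots,n-1\}$, and let $S$ and $T$ be the $(n-1)\times(n-1)$ complex matrices, indexed by $P_+$, with entries $$S_{ab}=\sqrt{\tfrac{2}{n}}\,\sin\!\Big(\pi\frac{ab}{n}\Big),\qquad T_{ab}=\exp\!\Big(\pi i\,\frac{a^2}{2n}\Big)\,\delta_{a,b}.$$ A *physical invariant* is an $(n-1)\times(n-1)$ matrix $M=(M_{ab})_{a,b\in P_+}$ with nonnegative integer entries such that $MS=SM$, $MT=TM$ and $M_{11}=1$. Identify $M$ with the formal expression $\sum_{a,b=1}^{n-1}M_{ab}\,\chi_a\chi_b^*$, where $|x|^2$ means $xx^*$, and write $Ja=n-a$ for $a\in P_+$. Then the complete list of physical invariants is the following; that is, every physical invariant for the given $n$ occurs in the list, and conversely every matrix listed for the given $n$ is a physical invariant: - $\mathcal A_{n-1}=\sum_{a=1}^{n-1}|\chi_a|^2$, for every $n\ge 3$; - $\mathcal D_{\frac n2+1}=\sum_{a=1}^{n-1}\chi_a\,\chi_{J^{a-1}a}^*$, when $n$ is even and $\frac n2$ is even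 (here $J^{a-1}a=a$ for $a$ odd and $J^{a-1}a=n-a$ for $a$ even; for $n=4$ this coincides with $\mathcal A_3$); - $\mathcal D_{\frac n2+1}=\sum_{a\text{ odd},\,1\le a<n/2}|\chi_a+\chi_{Ja}|^2+2\,|\chi_{n/2}|^2$, when $n$ is even and $\frac n2$ is odd; - $\mathcal E_6=|\chi_1+\chi_7|^2+|\chi_4+\chi_8|^2+|\chi_5+\chi_{11}|^2$, when $n=12$; - $\mathcal E_7=|\chi_1+\chi_{17}|^2+|\chi_5+\chi_{13}|^2+|\chi_7+\chi_{11}|^2+\chi_9(\chi_3+\chi_{15})^*+(\chi_3+\chi_{15})\chi_9^*+|\chi_9|^2$, when $n=18$; - $\mathcal E_8=|\chi_1+\chi_{11}+\chi_{19}+\chi_{29}|^2+|\chi_7+\chi_{13}+\chi_{17}+\chi_{23}|^2$, when $n=30$. -/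

import Mathlib

namespace ADE

/-- The index set `P_+ = {1, 2, …, n - 1}`. -/
abbrev Label (n : ℕ) : Type := ↥(Finset.Ico 1 n)

/-- The element `1` of `P_+`. -/
def one (n : ℕ) (hn : 3 ≤ n) : Label n :=
  ⟨1, Finset.mem_Ico.mpr ⟨le_refl 1, by omega⟩⟩

/-- The matrix `S_{ab} = √(2/n) sin(π a b / n)`. -/
noncomputable def matS (n : ℕ) : Matrix (Label n) (Label n) ℂ :=
  Matrix.of fun a b =>
    ((Real.sqrt (2 / (n : ℝ)) * Real.sin (Real.pi * ((a : ℕ) * (b : ℕ) : ℝ) / (n : ℝ)) : ℝ) : ℂ)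

/-- The diagonal matrix `T_{ab} = exp(π i a² / (2 n)) δ_{ab}`. -/
noncomputable def matT (n : ℕ) : Matrix (Label n) (Label n) ℂ :=
  Matrix.diagonal fun a =>
    Complex.exp ((Real.pi : ℂ) * Complex.I * ((a : ℕ) : ℂ) ^ 2 / (2 * (n : ℂ)))

/-- Physical invariants: matrices with nonnegative integer entries, regarded as complex matrices
when multiplied by `S` and `T`. -/
structure IsPhysicalInvariant (n : ℕ) (hn : 3 ≤ n) (M : Matrix (Label n) (Label n) ℕ) : Prop where
  comm_S : M.map (Nat.cast : ℕ → ℂ) * matS n = matS n * M.map (Nat.cast : ℕ → ℂ)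
  comm_T : M.map (Nat.cast : ℕ → ℂ) * matT n = matT n * M.map (Nat.cast : ℕ → ℂ)
  normalised : M (one n hn) (one n hn) = 1

/-- The coefficient matrix of the form `(∑_{a ∈ s} χ_a) (∑_{b ∈ t} χ_b)^*`. -/
def block (n : ℕ) (s t : Finset ℕ) : Matrix (Label n) (Label n) ℕ :=
  Matrix.of fun a b => if (a : ℕ) ∈ s ∧ (b : ℕ) ∈ t then 1 else 0

/-- The coefficient matrix of `|∑_{a ∈ s} χ_a|²`. -/
def sqBlock (n : ℕ) (s : Finset ℕ) : Matrix (Label n) (Label n) ℕ := block n s s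

/-- `A_{n-1} = ∑_a |χ_a|²`. -/
def invA (n : ℕ) : Matrix (Label n) (Label n) ℕ :=
  ∑ a ∈ Finset.Ico 1 n, sqBlock n {a}

/-- `D_{n/2+1}` for `n/2` even: `∑_a χ_a χ_{J^{a-1} a}^*` with `J a = n - a`, so that the odd
labels are fixed and each even label `a` is paired with `n - a`. -/
def invDPerm (n : ℕ) : Matrix (Label n) (Label n) ℕ :=
  ∑ a ∈ Finset.Ico 1 n, block n {a} {(fun c => n - c)^[a - 1] a}

/-- `D_{n/2+1}` for `n/2` odd:
`|χ_1 + χ_{J1}|² + |χ_3 + χ_{J3}|² + ⋯ + 2 |χ_{n/2}|²`, where the squares of sums run over the odd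
labels below `n/2`. -/
def invDBlock (n : ℕ) : Matrix (Label n) (Label n) ℕ :=
  (∑ a ∈ (Finset.Ico 1 (n / 2)).filter (fun a => Odd a), sqBlock n {a, n - a})
    + 2 • sqBlock n {n / 2}

/-- `E_6`, used for `n = 12`. -/
def invE6 (n : ℕ) : Matrix (Label n) (Label n) ℕ :=
  sqBlock n {1, 7} + sqBlock n {4, 8} + sqBlock n {5, 11}

/-- `E_7`, used for `n = 18`. -/
def invE7 (n : ℕ) : Matrix (Label n) (Label n) ℕ :=
  sqBlock n {1, 17} + sqBlock n {5, 13} + sqBlock n {7, 11}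
    + block n {9} {3, 15} + block n {3, 15} {9} + sqBlock n {9}

/-- `E_8`, used for `n = 30`. -/
def invE8 (n : ℕ) : Matrix (Label n) (Label n) ℕ :=
  sqBlock n {1, 11, 19, 29} + sqBlock n {7, 13, 17, 23}

end ADE

open Finset

namespace ADE

/-! After cancelling `√(2/n)`, commutation with `S` is a family of relations with natural-number
coefficients between the sines `sin(πk/n)`. Commutation with `T` says that `M_ab ≠ 0` forces `a² ≡
b²` modulo `4n` (`isPhysicalInvariant_iff`). Two mechanisms then carry the proof.

Galois symmetry. With `ζ = exp(πi/n)` one has `2i sin(πk/n) = ζ^k - ζ^(-k)`, so the relations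
survive the substitution `k ↦ lk` for every `l` coprime to `2n`. Multiplication by `l` permutes the
labels up to sign, `la ≡ ε(a) a'` modulo `2n`, and inverting `S` gives `ε(b) M_ab = ε(a) M_a'b'`. As
entries are nonnegative, `M_ab ≠ 0` forces `ε(a) = ε(b)`: this is the parity rule
`sinPi_galois_pos`. For `a = 1`, together with `b² ≡ 1` modulo `4n`, it leaves only `b = 1`, `b = n
- 1`, `b = 7` for `n = 12`, and `b = 11, 19` for `n = 30` (`label_eq_of_parity`).

Positivity. The first row of `S` is positive and `∑_c sin(πc/n) M_cb = ∑_c M_1c sin(πcb/n)`. Once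
the first row of `M` is known, so is the right side. If it is zero, the whole column `b` vanishes;
otherwise it bounds the entries, and its nonnegativity bounds the first row itself. A trivial first
row and column give a permutation matrix (`eq_of_trivial_row`). Support `{1, n - 1}` gives the block
`D` series, except that a column may concentrate on the middle label `n/2` when its sine is `1/2`;
this happens only for `n = 18` and yields `E₇` (`IsSimpleCurrentExtension.classification`). The
remaining first rows, at `n = 12` and `n = 30`, lead to `E₆` and `E₈` (`eq_tableE6`, `eq_tableE8`).

Conversely, the listed matrices are checked directly: the sine sums over the blocks of an
exceptional matrix are combinations of the indicator functions of blocks. -/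

/-! ### Sines of rational multiples of `π` and their orthogonality -/

/-- The real number `sin (π k / n)`. -/
noncomputable def sinPi (n k : ℕ) : ℝ := Real.sin (Real.pi * k / n)

theorem sinPi_pos {n k : ℕ} (h1 : 1 ≤ k) (h2 : k < n) : 0 < sinPi n k := by
  have hk : (0 : ℝ) < k := by exact_mod_cast h1
  have hn : (k : ℝ) < n := by exact_mod_cast h2
  have hn0 : (0 : ℝ) < n := hk.trans hn
  apply Real.sin_pos_of_pos_of_lt_pi
  · have := Real.pi_pos
    positivity
  · rw [div_lt_iff₀ hn0]
    exact mul_lt_mul_of_pos_left hn Real.pi_pos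

theorem sinPi_sub_mul {n a : ℕ} (hn : 0 < n) (ha : a ≤ n) (b : ℕ) :
    sinPi n ((n - a) * b) = (-1) ^ (b + 1) * sinPi n (a * b) := by
  have hn0 : (n : ℝ) ≠ 0 := by exact_mod_cast hn.ne'
  unfold sinPi
  have : Real.pi * (((n - a) * b : ℕ) : ℝ) / n = (b : ℝ) * Real.pi - Real.pi * ((a * b : ℕ) : ℝ) / n := by
    push_cast [Nat.cast_sub ha]
    field_simp
  rw [this, Real.sin_nat_mul_pi_sub, pow_succ]
  ring

theorem sinPi_mul_sub {n b : ℕ} (hn : 0 < n) (hb : b ≤ n) (a : ℕ) :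
    sinPi n (a * (n - b)) = (-1) ^ (a + 1) * sinPi n (a * b) := by
  rw [mul_comm, sinPi_sub_mul hn hb, mul_comm b]

theorem sinPi_sub {n a : ℕ} (hn : 0 < n) (ha : a ≤ n) : sinPi n (n - a) = sinPi n a := by
  simpa using sinPi_sub_mul hn ha 1

theorem sinPi_add_two_mul {n : ℕ} (hn : 0 < n) (k q : ℕ) :
    sinPi n (k + 2 * n * q) = sinPi n k := by
  have hn0 : (n : ℝ) ≠ 0 := by exact_mod_cast hn.ne'
  unfold sinPi
  rw [← Real.sin_add_nat_mul_two_pi (Real.pi * k / n) q]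
  congr 1
  push_cast
  field_simp

theorem sinPi_mod {n : ℕ} (hn : 0 < n) (k : ℕ) : sinPi n k = sinPi n (k % (2 * n)) := by
  conv_lhs => rw [← Nat.mod_add_div k (2 * n)]
  exact sinPi_add_two_mul hn _ _

theorem sinPi_two_mul_sub {n k : ℕ} (hn : 0 < n) (hk : k ≤ 2 * n) :
    sinPi n (2 * n - k) = -sinPi n k := by
  have hn0 : (n : ℝ) ≠ 0 := by exact_mod_cast hn.ne'
  unfold sinPi
  rw [← Real.sin_two_pi_sub]
  congr 1
  push_cast [Nat.cast_sub hk]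
  field_simp

theorem sinPi_eq_imp {n a b : ℕ} (ha : a < n) (hb : b < n)
    (h : sinPi n a = sinPi n b) : b = a ∨ b = n - a := by
  have hn0 : (n : ℝ) ≠ 0 := by
    have : n ≠ 0 := by omega
    exact_mod_cast this
  unfold sinPi at h
  rw [Real.sin_eq_sin_iff] at h
  obtain ⟨k, hk | hk⟩ := h
  · left
    have h1 : (b : ℝ) = 2 * k * n + a := by
      field_simp at hk
      have := Real.pi_pos
      nlinarith
    have h2 : (b : ℤ) = 2 * k * n + a := by exact_mod_cast h1
    rcases lt_trichotomy k 0 with hk0 | hk0 | hk0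
    · nlinarith
    · subst hk0; omega
    · nlinarith
  · right
    have h1 : (b : ℝ) = (2 * k + 1) * n - a := by
      field_simp at hk
      have := Real.pi_pos
      nlinarith
    have h2 : (b : ℤ) = (2 * k + 1) * n - a := by exact_mod_cast h1
    rcases lt_trichotomy k 0 with hk0 | hk0 | hk0
    · nlinarith
    · subst hk0; omega
    · nlinarith

/-- Multiplying by `2 sin(θ/2)` makes the sum of cosines telescope. -/
theorem sum_cos_mul_sin_half (θ : ℝ) (m : ℕ) :
    (∑ c ∈ range m, Real.cos (c * θ)) * (2 * Real.sin (θ / 2))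
      = Real.sin (m * θ - θ / 2) + Real.sin (θ / 2) := by
  induction m with
  | zero => simp
  | succ m ih =>
    rw [sum_range_succ, add_mul, ih]
    have e1 : ((m + 1 : ℕ) : ℝ) * θ - θ / 2 = m * θ + θ / 2 := by push_cast; ring
    rw [e1, Real.sin_add, Real.sin_sub]
    ring

theorem sum_cos_pi {n : ℕ} {k : ℤ} (hk : k ≠ 0) (hkn : |k| < 2 * n) :
    ∑ c ∈ range n, Real.cos (c * (Real.pi * k / n)) = (1 - (-1) ^ k) / 2 := by
  have hn : n ≠ 0 := by rintro rfl; have := abs_nonneg k; simp at hkn; omega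
  have hn0 : (n : ℝ) ≠ 0 := by exact_mod_cast hn
  have h := sum_cos_mul_sin_half (Real.pi * k / n) n
  have e : (n : ℝ) * (Real.pi * k / n) - Real.pi * k / n / 2
      = k * Real.pi - Real.pi * k / n / 2 := by field_simp
  rw [e, Real.sin_int_mul_pi_sub] at h
  have hs : Real.sin (Real.pi * k / n / 2) ≠ 0 := by
    rw [Ne, Real.sin_eq_zero_iff]
    rintro ⟨q, hq⟩
    have h1 : (k : ℝ) = 2 * n * q := by
      field_simp at hq
      have := Real.pi_pos
      nlinarith
    have h2 : k = 2 * n * q := by exact_mod_cast h1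
    have : q ≠ 0 := by rintro rfl; simp at h2; exact hk h2
    have h3 : 1 ≤ |q| := Int.one_le_abs this
    rw [h2, abs_mul, abs_of_nonneg (by positivity)] at hkn
    have : (0 : ℤ) < n := by positivity
    nlinarith
  have h4 : (∑ c ∈ range n, Real.cos (c * (Real.pi * k / n)))
      * (2 * Real.sin (Real.pi * k / n / 2))
      = ((1 - (-1) ^ k) / 2) * (2 * Real.sin (Real.pi * k / n / 2)) := by
    rw [h]; ring
  exact mul_right_cancel₀ (by simpa using hs) h4

/-- This is `S² = 1` without the normalising factor, so that `S` can be inverted in later arguments.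
Products become cosines of the angles for `a - b` and `a + b`; these integers have equal parity, so
their cosine sums cancel unless `a = b`. -/
theorem sum_sinPi_mul_sinPi {n a b : ℕ} (ha : 1 ≤ a) (ha' : a < n) (hb : 1 ≤ b) (hb' : b < n) :
    ∑ c ∈ Ico 1 n, sinPi n (a * c) * sinPi n (c * b) = if a = b then (n : ℝ) / 2 else 0 := by
  have hr : ∑ c ∈ Ico 1 n, sinPi n (a * c) * sinPi n (c * b)
      = ∑ c ∈ range n, sinPi n (a * c) * sinPi n (c * b) := by
    rw [range_eq_Ico, sum_eq_sum_Ico_succ_bot (by omega : 0 < n)]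
    simp [sinPi]
  have hterm : ∀ c : ℕ, sinPi n (a * c) * sinPi n (c * b)
      = (Real.cos (c * (Real.pi * ((a - b : ℤ) : ℝ) / n))
        - Real.cos (c * (Real.pi * ((a + b : ℤ) : ℝ) / n))) / 2 := by
    intro c
    unfold sinPi
    have e1 : (c : ℝ) * (Real.pi * ((a - b : ℤ) : ℝ) / n)
        = Real.pi * ((a * c : ℕ) : ℝ) / n - Real.pi * ((c * b : ℕ) : ℝ) / n := by
      push_cast; ring
    have e2 : (c : ℝ) * (Real.pi * ((a + b : ℤ) : ℝ) / n)
        = Real.pi * ((a * c : ℕ) : ℝ) / n + Real.pi * ((c * b : ℕ) : ℝ) / n := by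
      push_cast; ring
    rw [e1, e2, Real.cos_sub, Real.cos_add]
    ring
  rw [hr, sum_congr rfl fun c _ => hterm c, ← sum_div, sum_sub_distrib,
    sum_cos_pi (k := (a + b : ℤ)) (by omega) (by rw [abs_lt]; omega)]
  split_ifs with hab
  · subst hab
    have : (-1 : ℝ) ^ ((a : ℤ) + a) = 1 := by
      rw [← two_mul]; exact Even.neg_one_zpow (even_two_mul _)
    simp [this]
  · rw [sum_cos_pi (k := (a - b : ℤ)) (by omega) (by rw [abs_lt]; omega)]
    have : (-1 : ℝ) ^ ((a : ℤ) + b) = (-1) ^ ((a : ℤ) - b) := by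
      rw [show (a : ℤ) + b = (a - b) + 2 * b by ring, zpow_add₀ (by norm_num),
        Even.neg_one_zpow (even_two_mul (b : ℤ)), mul_one]
    rw [this]; ring

/-! ### Reformulation as relations between real sines and congruences modulo `4 n` -/

/-- The conditions on a physical invariant, for a table of natural numbers of which only the
entries with indices in `{1, …, n - 1}` matter. -/
structure IsInvariantTable (n : ℕ) (m : ℕ → ℕ → ℕ) : Prop where
  comm : ∀ a b, 1 ≤ a → a < n → 1 ≤ b → b < n →
    ∑ c ∈ Ico 1 n, (m a c : ℝ) * sinPi n (c * b) = ∑ c ∈ Ico 1 n, sinPi n (a * c) * (m c b : ℝ)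
  sq_modEq : ∀ a b, 1 ≤ a → a < n → 1 ≤ b → b < n → m a b ≠ 0 → a ^ 2 ≡ b ^ 2 [MOD 4 * n]
  one_one : m 1 1 = 1

theorem IsInvariantTable.transpose {n : ℕ} {m : ℕ → ℕ → ℕ} (h : IsInvariantTable n m) :
    IsInvariantTable n fun a b => m b a where
  comm a b ha ha' hb hb' := by
    have := h.comm b a hb hb' ha ha'
    simp only [mul_comm] at this ⊢
    exact this.symm
  sq_modEq a b ha ha' hb hb' hab := (h.sq_modEq b a hb hb' ha ha' hab).symm
  one_one := h.one_one

/-- The table of a matrix indexed by labels, extended by zero. -/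
def toTable {n : ℕ} (M : Matrix (Label n) (Label n) ℕ) (a b : ℕ) : ℕ :=
  if h : a ∈ Ico 1 n ∧ b ∈ Ico 1 n then M ⟨a, h.1⟩ ⟨b, h.2⟩ else 0

theorem toTable_coe {n : ℕ} (M : Matrix (Label n) (Label n) ℕ) (a b : Label n) :
    toTable M a b = M a b := by
  unfold toTable
  rw [dif_pos ⟨a.2, b.2⟩]

theorem exp_sq_eq_iff {n a b : ℕ} (hn : 0 < n) :
    Complex.exp ((Real.pi : ℂ) * Complex.I * (a : ℂ) ^ 2 / (2 * (n : ℂ)))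
      = Complex.exp ((Real.pi : ℂ) * Complex.I * (b : ℂ) ^ 2 / (2 * (n : ℂ)))
    ↔ a ^ 2 ≡ b ^ 2 [MOD 4 * n] := by
  have hn0 : (n : ℂ) ≠ 0 := by exact_mod_cast hn.ne'
  have hpi : (Real.pi : ℂ) ≠ 0 := by exact_mod_cast Real.pi_ne_zero
  rw [Complex.exp_eq_exp_iff_exists_int, ← Int.natCast_modEq_iff, Int.modEq_comm,
    Int.modEq_iff_dvd]
  constructor
  · rintro ⟨k, hk⟩
    refine ⟨k, ?_⟩
    field_simp at hk
    have : (a : ℂ) ^ 2 - b ^ 2 = 4 * n * k := by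
      have h2 : (2 : ℂ) ≠ 0 := two_ne_zero
      linear_combination hk
    exact_mod_cast this
  · rintro ⟨k, hk⟩
    refine ⟨k, ?_⟩
    have : (a : ℂ) ^ 2 - b ^ 2 = 4 * n * k := by exact_mod_cast hk
    field_simp
    linear_combination this

/-- The nonzero factor `√(2/n)` cancels from both sides of `MS = SM`. Since `T` is diagonal, `MT =
TM` says entry by entry that `M_ab` vanishes or the eigenvalues at `a` and `b` agree. -/
theorem isPhysicalInvariant_iff {n : ℕ} (hn : 3 ≤ n) (M : Matrix (Label n) (Label n) ℕ) :
    IsPhysicalInvariant n hn M ↔ IsInvariantTable n (toTable M) := by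
  have hS : ∀ a b : Label n, matS n a b = ((Real.sqrt (2 / n) * sinPi n (a * b) : ℝ) : ℂ) := by
    intro a b
    simp [matS, sinPi]
  have hr : Real.sqrt (2 / (n : ℝ)) ≠ 0 := by
    have : (0 : ℝ) < n := by exact_mod_cast (by omega : 0 < n)
    positivity
  have hcomm : M.map (Nat.cast : ℕ → ℂ) * matS n = matS n * M.map (Nat.cast : ℕ → ℂ) ↔
      ∀ a b, 1 ≤ a → a < n → 1 ≤ b → b < n →
        ∑ c ∈ Ico 1 n, (toTable M a c : ℝ) * sinPi n (c * b)
          = ∑ c ∈ Ico 1 n, sinPi n (a * c) * (toTable M c b : ℝ) := by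
    have key : ∀ a b : Label n,
        (M.map (Nat.cast : ℕ → ℂ) * matS n) a b = (matS n * M.map (Nat.cast : ℕ → ℂ)) a b ↔
        ∑ c ∈ Ico 1 n, (toTable M a c : ℝ) * sinPi n (c * b)
          = ∑ c ∈ Ico 1 n, sinPi n (a * c) * (toTable M c b : ℝ) := by
      intro a b
      rw [← sum_coe_sort (Ico 1 n), ← sum_coe_sort (Ico 1 n)]
      simp only [Matrix.mul_apply, Matrix.map_apply, hS, toTable_coe]
      rw [← mul_right_inj' hr, mul_sum, mul_sum, ← Complex.ofReal_inj]
      push_cast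
      simp only [mul_left_comm, mul_assoc]
    constructor
    · intro h a b ha ha' hb hb'
      exact (key ⟨a, by simp [*]⟩ ⟨b, by simp [*]⟩).1 (by rw [h])
    · intro h
      ext a b
      have ha := mem_Ico.1 a.2
      have hb := mem_Ico.1 b.2
      exact (key a b).2 (h a b ha.1 ha.2 hb.1 hb.2)
  have hT : M.map (Nat.cast : ℕ → ℂ) * matT n = matT n * M.map (Nat.cast : ℕ → ℂ) ↔
      ∀ a b, 1 ≤ a → a < n → 1 ≤ b → b < n → toTable M a b ≠ 0 → a ^ 2 ≡ b ^ 2 [MOD 4 * n] := by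
    have key : ∀ a b : Label n,
        (M.map (Nat.cast : ℕ → ℂ) * matT n) a b = (matT n * M.map (Nat.cast : ℕ → ℂ)) a b ↔
        (toTable M a b ≠ 0 → (a : ℕ) ^ 2 ≡ (b : ℕ) ^ 2 [MOD 4 * n]) := by
      intro a b
      rw [← exp_sq_eq_iff (by omega : 0 < n), matT, Matrix.mul_diagonal, Matrix.diagonal_mul,
        toTable_coe, Matrix.map_apply, mul_comm, mul_eq_mul_right_iff, Nat.cast_eq_zero, eq_comm]
      tauto
    constructor
    · intro h a b ha ha' hb hb'
      exact (key ⟨a, by simp [*]⟩ ⟨b, by simp [*]⟩).1 (by rw [h])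
    · intro h
      ext a b
      have ha := mem_Ico.1 a.2
      have hb := mem_Ico.1 b.2
      exact (key a b).2 (h a b ha.1 ha.2 hb.1 hb.2)
  have h1 : toTable M 1 1 = M (one n hn) (one n hn) := toTable_coe M (one n hn) (one n hn)
  constructor
  · intro h
    exact ⟨hcomm.1 h.comm_S, hT.1 h.comm_T, h1.trans h.normalised⟩
  · intro h
    exact ⟨hcomm.2 h.comm, hT.2 h.sq_modEq, h1.symm.trans h.one_one⟩

/-! ### Galois symmetry and the parity rule -/

/-- The exponent `(2 n - 1) k` stands for `-k`, which keeps the expression a polynomial in the root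
of unity. -/
theorem exp_pow_sub_pow (n : ℕ) (hn : 0 < n) (k : ℕ) :
    Complex.exp (2 * Real.pi * Complex.I / (2 * n : ℕ)) ^ k
      - Complex.exp (2 * Real.pi * Complex.I / (2 * n : ℕ)) ^ ((2 * n - 1) * k)
      = 2 * Complex.I * (sinPi n k : ℂ) := by
  have hn0 : (n : ℂ) ≠ 0 := by exact_mod_cast hn.ne'
  have e1 : Complex.exp (2 * Real.pi * Complex.I / (2 * n : ℕ)) ^ k
      = Complex.exp ((Real.pi * k / n : ℂ) * Complex.I) := by
    rw [← Complex.exp_nat_mul]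
    congr 1
    push_cast
    field_simp
  have e2 : Complex.exp (2 * Real.pi * Complex.I / (2 * n : ℕ)) ^ ((2 * n - 1) * k)
      = Complex.exp (-(Real.pi * k / n : ℂ) * Complex.I) := by
    rw [← Complex.exp_nat_mul, Complex.exp_eq_exp_iff_exists_int]
    refine ⟨k, ?_⟩
    push_cast [Nat.cast_sub (by omega : 1 ≤ 2 * n)]
    field_simp
    ring
  have e3 : (sinPi n k : ℂ) = Complex.sin (Real.pi * k / n) := by
    unfold sinPi; push_cast; rfl
  rw [e1, e2, e3, Complex.sin]
  linear_combination (Complex.exp ((Real.pi * k / n : ℂ) * Complex.I)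
    - Complex.exp (-(Real.pi * k / n : ℂ) * Complex.I)) * Complex.I_sq

open Polynomial in
/-- The integral relations between the numbers `sin (π k / n)` are stable under the Galois
action. -/
theorem sum_sinPi_galois {n l : ℕ} (hn : 0 < n) (hl : Nat.Coprime l (2 * n)) {ι : Type*}
    (I : Finset ι) (w w' : ι → ℤ) (k k' : ι → ℕ)
    (h : ∑ i ∈ I, (w i : ℝ) * sinPi n (k i) = ∑ i ∈ I, (w' i : ℝ) * sinPi n (k' i)) :
    ∑ i ∈ I, (w i : ℝ) * sinPi n (l * k i) = ∑ i ∈ I, (w' i : ℝ) * sinPi n (l * k' i) := by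
  set ζ : ℂ := Complex.exp (2 * Real.pi * Complex.I / (2 * n : ℕ)) with hζ
  have hprim : IsPrimitiveRoot ζ (2 * n) := Complex.isPrimitiveRoot_exp _ (by omega)
  have hprim' : IsPrimitiveRoot (ζ ^ l) (2 * n) := hprim.pow_of_coprime l hl
  let P : ℤ[X] := ∑ i ∈ I, (C (w i) * (X ^ k i - X ^ ((2 * n - 1) * k i))
    - C (w' i) * (X ^ k' i - X ^ ((2 * n - 1) * k' i)))
  have hP : ∀ j : ℕ, aeval (ζ ^ j) P = 2 * Complex.I *
      ((∑ i ∈ I, (w i : ℝ) * sinPi n (j * k i) - ∑ i ∈ I, (w' i : ℝ) * sinPi n (j * k' i) : ℝ) : ℂ) := by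
    intro j
    have hpow : ∀ q : ℕ, (ζ ^ j) ^ q - (ζ ^ j) ^ ((2 * n - 1) * q)
        = 2 * Complex.I * (sinPi n (j * q) : ℂ) := by
      intro q
      rw [← exp_pow_sub_pow n hn, ← pow_mul, ← pow_mul]
      congr 2
      ring
    simp only [P, map_sum, map_sub, map_mul, map_pow, aeval_X, aeval_C, hpow]
    push_cast
    rw [← sum_sub_distrib, mul_sum]
    refine sum_congr rfl fun i _ => ?_
    simp only [algebraMap_int_eq, eq_intCast]
    ring
  have h0 : aeval ζ P = 0 := by
    have := hP 1
    simp only [pow_one, one_mul] at this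
    rw [this, h, sub_self]
    simp
  -- The relation says that `ζ` is a root of `P`. The minimal polynomial of `ζ` is cyclotomic, hence
  -- shared by `ζ ^ l`, so `ζ ^ l` is a root of `P` as well.
  have hdvd : cyclotomic (2 * n) ℤ ∣ P := by
    rw [cyclotomic_eq_minpoly hprim (by omega)]
    exact minpoly.isIntegrallyClosed_dvd (hprim.isIntegral (by omega)) h0
  have h1 : aeval (ζ ^ l) P = 0 := by
    obtain ⟨Q, hQ⟩ := hdvd
    rw [hQ, map_mul, cyclotomic_eq_minpoly hprim' (by omega), minpoly.aeval, zero_mul]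
  rw [hP l] at h1
  have h2 : (2 : ℂ) * Complex.I ≠ 0 := by simp
  have h3 := (mul_eq_zero.1 h1).resolve_left h2
  exact sub_eq_zero.1 (by exact_mod_cast h3)

/-- Multiplication by a unit modulo `2 n` permutes the labels up to sign. -/
theorem exists_sinPi_galois {n l a : ℕ} (hl : Nat.Coprime l (2 * n)) (ha : 1 ≤ a) (ha' : a < n) :
    ∃ a' : ℕ, ∃ ε : ℤ, 1 ≤ a' ∧ a' < n ∧ (ε = 1 ∨ ε = -1) ∧ ((2 * n : ℕ) : ℤ) ∣ l * a - ε * a' ∧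
      ∀ k, sinPi n (l * (a * k)) = ε * sinPi n (a' * k) := by
  have hn : 0 < n := by omega
  set r := l * a % (2 * n) with hr
  have hr2 : r < 2 * n := Nat.mod_lt _ (by omega)
  have hmod := Nat.mod_add_div (l * a) (2 * n)
  rw [← hr] at hmod
  -- The residue of `l a` avoids `0` and `n`, so it either is a label or becomes one after
  -- reflection in `2 n`, at the cost of a sign.
  have hndvd : ¬ n ∣ r := by
    intro hd
    have h1 : n ∣ l * a := by
      rw [← hmod]
      exact dvd_add hd (Dvd.intro_left 2 rfl |>.mul_right _)
    have h2 : n ∣ a := (Nat.Coprime.coprime_mul_left_right hl).symm.dvd_of_dvd_mul_left h1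
    exact absurd (Nat.le_of_dvd (by omega) h2) (by omega)
  have hr0 : r ≠ 0 := by rintro h; exact hndvd (h ▸ dvd_zero n)
  have hrn : r ≠ n := by rintro h; exact hndvd (h ▸ dvd_refl n)
  have hs : ∀ k, sinPi n (l * (a * k)) = sinPi n (r * k) := by
    intro k
    rw [← sinPi_add_two_mul hn (r * k) (l * a / (2 * n) * k)]
    congr 1
    calc l * (a * k) = (l * a) * k := by ring
      _ = (r + 2 * n * (l * a / (2 * n))) * k := by rw [hmod]
      _ = _ := by ring
  have hz : (l : ℤ) * a = r + 2 * n * (l * a / (2 * n) : ℕ) := by exact_mod_cast hmod.symm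
  rcases lt_or_gt_of_ne hrn with hlt | hgt
  · refine ⟨r, 1, by omega, hlt, Or.inl rfl, ⟨(l * a / (2 * n) : ℕ), ?_⟩, ?_⟩
    · rw [hz]; push_cast; ring
    · intro k; rw [hs]; simp
  · refine ⟨2 * n - r, -1, by omega, by omega, Or.inr rfl, ⟨(l * a / (2 * n) : ℕ) + 1, ?_⟩, ?_⟩
    · rw [hz]; push_cast [Nat.cast_sub hr2.le]; ring
    · intro k
      rw [hs]
      have hn0 : (n : ℝ) ≠ 0 := by exact_mod_cast hn.ne'
      unfold sinPi
      have : Real.pi * (((2 * n - r) * k : ℕ) : ℝ) / n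
          = k * (2 * Real.pi) - Real.pi * ((r * k : ℕ) : ℝ) / n := by
        push_cast [Nat.cast_sub hr2.le]
        field_simp
      rw [this, Real.sin_nat_mul_two_pi_sub]
      simp

/-- Cancelling the unit `l` gives `a ≡ ± b` modulo `2 n`; as `0 < a + b < 2 n`, only `a = b` is
possible. -/
theorem galois_injective {n l a b a' : ℕ} {ε δ : ℤ} (hl : Nat.Coprime l (2 * n))
    (ha : 1 ≤ a) (ha' : a < n) (hb : 1 ≤ b) (hb' : b < n)
    (hε : ε = 1 ∨ ε = -1) (hδ : δ = 1 ∨ δ = -1)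
    (h1 : ((2 * n : ℕ) : ℤ) ∣ l * a - ε * a') (h2 : ((2 * n : ℕ) : ℤ) ∣ l * b - δ * a') : a = b := by
  have hcop : IsCoprime ((2 * n : ℕ) : ℤ) (l : ℤ) := (Nat.isCoprime_iff_coprime.2 hl).symm
  have h3 : ((2 * n : ℕ) : ℤ) ∣ l * (a - ε * δ * b) := by
    have h4 := dvd_sub h1 (h2.mul_left (ε * δ))
    have hδ2 : δ * δ = 1 := by rcases hδ with rfl | rfl <;> norm_num
    have : (l : ℤ) * a - ε * a' - ε * δ * (l * b - δ * a') = l * (a - ε * δ * b) := by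
      linear_combination (ε * a') * hδ2
    rwa [this] at h4
  have h5 := hcop.dvd_of_dvd_mul_left h3
  have hεδ : ε * δ = 1 ∨ ε * δ = -1 := by
    rcases hε with rfl | rfl <;> rcases hδ with rfl | rfl <;> norm_num
  rcases hεδ with h | h <;> rw [h] at h5
  · have := Int.eq_zero_of_abs_lt_dvd h5 (by rw [abs_lt]; push_cast; omega)
    omega
  · have := Int.le_of_dvd (by omega) h5
    push_cast at this
    omega

namespace IsInvariantTable

variable {n : ℕ} {m : ℕ → ℕ → ℕ}

theorem comm_galois (h : IsInvariantTable n m) {l : ℕ} (hl : Nat.Coprime l (2 * n))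
    {a b : ℕ} (ha : 1 ≤ a) (ha' : a < n) (hb : 1 ≤ b) (hb' : b < n) :
    ∑ c ∈ Ico 1 n, (m a c : ℝ) * sinPi n (l * (c * b))
      = ∑ c ∈ Ico 1 n, sinPi n (l * (a * c)) * (m c b : ℝ) := by
  have h0 := h.comm a b ha ha' hb hb'
  have := sum_sinPi_galois (n := n) (by omega) hl (Ico 1 n) (fun c => (m a c : ℤ))
    (fun c => (m c b : ℤ)) (fun c => c * b) (fun c => a * c)
    (by simpa only [Int.cast_natCast, mul_comm] using h0)
  simpa only [Int.cast_natCast, mul_comm] using this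

/-- The parity rule. -/
theorem sinPi_galois_pos (h : IsInvariantTable n m) {l : ℕ} (hl : Nat.Coprime l (2 * n))
    {a b : ℕ} (ha : 1 ≤ a) (ha' : a < n) (hb : 1 ≤ b) (hb' : b < n) (hab : m a b ≠ 0) :
    0 < sinPi n (l * a) * sinPi n (l * b) := by
  have hn0 : (0 : ℝ) < n := by exact_mod_cast (by omega : 0 < n)
  choose! g ε hg1 hgn hε hdvd hs using
    fun (c : ℕ) (hc : 1 ≤ c ∧ c < n) => exists_sinPi_galois hl hc.1 hc.2
  have hA := hs a ⟨ha, ha'⟩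
  have hB := hs b ⟨hb, hb'⟩
  -- Multiplying the conjugated relation by `S` evaluates each side by orthogonality. The left side
  -- isolates `m a b` with the sign of `b`, the right side isolates `m (g a) (g b)` with the sign of
  -- `a`.
  have key : ∑ d ∈ Ico 1 n, (∑ c ∈ Ico 1 n, (m a c : ℝ) * sinPi n (l * (c * d))) * sinPi n (d * g b)
      = ∑ d ∈ Ico 1 n, (ε a * ∑ c ∈ Ico 1 n, (m (g a) c : ℝ) * sinPi n (c * d)) * sinPi n (d * g b) := by
    refine sum_congr rfl fun d hd => ?_
    have hd := mem_Ico.1 hd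
    rw [h.comm_galois hl ha ha' hd.1 hd.2, h.comm (g a) d (hg1 a ⟨ha, ha'⟩) (hgn a ⟨ha, ha'⟩) hd.1 hd.2,
      mul_sum]
    congr 1
    refine sum_congr rfl fun c _ => ?_
    rw [hA]; ring
  have hL : ∑ d ∈ Ico 1 n, (∑ c ∈ Ico 1 n, (m a c : ℝ) * sinPi n (l * (c * d))) * sinPi n (d * g b)
      = (m a b : ℝ) * ε b * (n / 2) := by
    calc _ = ∑ c ∈ Ico 1 n, (m a c : ℝ) * ε c * ∑ d ∈ Ico 1 n, sinPi n (g c * d) * sinPi n (d * g b) := by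
          simp only [sum_mul, mul_sum]
          rw [sum_comm]
          refine sum_congr rfl fun c hc => sum_congr rfl fun d _ => ?_
          rw [hs c (mem_Ico.1 hc)]; ring
      _ = ∑ c ∈ Ico 1 n, if c = b then (m a b : ℝ) * ε b * (n / 2) else 0 := by
          refine sum_congr rfl fun c hc => ?_
          have hc := mem_Ico.1 hc
          rw [sum_sinPi_mul_sinPi (hg1 c hc) (hgn c hc) (hg1 b ⟨hb, hb'⟩) (hgn b ⟨hb, hb'⟩)]
          by_cases hcb : c = b
          · subst hcb; simp
          · have : g c ≠ g b := fun e => hcb (galois_injective hl hc.1 hc.2 hb hb'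
              (hε c hc) (hε b ⟨hb, hb'⟩) (hdvd c hc) (e ▸ hdvd b ⟨hb, hb'⟩))
            simp [hcb, this]
      _ = _ := by simp [hb, hb']
  have hR : ∑ d ∈ Ico 1 n, (ε a * ∑ c ∈ Ico 1 n, (m (g a) c : ℝ) * sinPi n (c * d)) * sinPi n (d * g b)
      = ε a * (m (g a) (g b) : ℝ) * (n / 2) := by
    calc _ = ∑ c ∈ Ico 1 n, ε a * (m (g a) c : ℝ) * ∑ d ∈ Ico 1 n, sinPi n (c * d) * sinPi n (d * g b) := by
          simp only [sum_mul, mul_sum]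
          rw [sum_comm]
          refine sum_congr rfl fun c hc => sum_congr rfl fun d _ => ?_
          ring
      _ = ∑ c ∈ Ico 1 n, if c = g b then ε a * (m (g a) (g b) : ℝ) * (n / 2) else 0 := by
          refine sum_congr rfl fun c hc => ?_
          have hc := mem_Ico.1 hc
          rw [sum_sinPi_mul_sinPi hc.1 hc.2 (hg1 b ⟨hb, hb'⟩) (hgn b ⟨hb, hb'⟩)]
          by_cases hcb : c = g b
          · subst hcb; simp
          · simp [hcb]
      _ = _ := by
        have := hg1 b ⟨hb, hb'⟩
        have := hgn b ⟨hb, hb'⟩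
        simp [*]
  rw [hL, hR] at key
  have key2 : (m a b : ℝ) * ε b = ε a * (m (g a) (g b) : ℝ) :=
    mul_right_cancel₀ (by positivity) key
  have key3 : (m a b : ℤ) * ε b = ε a * (m (g a) (g b) : ℤ) := by exact_mod_cast key2
  have hpos : (0 : ℤ) < m a b := by exact_mod_cast Nat.pos_of_ne_zero hab
  -- The only use of nonnegativity: opposite signs would equate a positive and a nonpositive
  -- integer.
  have heq : ε a = ε b := by
    have h2 : (0 : ℤ) ≤ m (g a) (g b) := by positivity
    rcases hε a ⟨ha, ha'⟩ with e | e <;> rcases hε b ⟨hb, hb'⟩ with f | f <;> rw [e, f] at key3 ⊢ <;>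
      omega
  have h1 := hA 1
  have h2 := hB 1
  simp only [mul_one] at h1 h2
  rw [h1, h2, heq]
  have p1 := sinPi_pos (hg1 a ⟨ha, ha'⟩) (hgn a ⟨ha, ha'⟩)
  have p2 := sinPi_pos (hg1 b ⟨hb, hb'⟩) (hgn b ⟨hb, hb'⟩)
  have he : (ε b : ℝ) * ε b = 1 := by
    rcases hε b ⟨hb, hb'⟩ with f | f <;> rw [f] <;> norm_num
  calc (0 : ℝ) < sinPi n (g a) * sinPi n (g b) := mul_pos p1 p2
    _ = _ := by linear_combination (-(sinPi n (g a) * sinPi n (g b))) * he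

end IsInvariantTable

/-! ### Arithmetic of the parity rule: labels that can pair with `1` -/

/-- A solution of `b² ≡ 1` modulo `4 n` splits `2 n` into coprime factors modulo which it is
`1` and `-1`. -/
theorem exists_coprime_split {n b : ℕ} (hb : 1 ≤ b) (h : b ^ 2 ≡ 1 [MOD 4 * n]) :
    ∃ A B : ℕ, A * B = 2 * n ∧ Nat.Coprime A B ∧ A ∣ b - 1 ∧ B ∣ b + 1 ∧
      ((2 ∣ A ∧ ¬ 2 ∣ B) ∨ (¬ 2 ∣ A ∧ 4 ∣ B)) := by
  have hodd : b % 2 = 1 := by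
    have h2 : b ^ 2 ≡ 1 [MOD 2] := h.of_dvd ⟨2 * n, by ring⟩
    rcases Nat.mod_two_eq_zero_or_one b with h0 | h0
    · have : b ^ 2 % 2 = 0 := by rw [Nat.pow_mod, h0]
      unfold Nat.ModEq at h2
      omega
    · exact h0
  obtain ⟨c, rfl⟩ : ∃ c, b = 2 * c + 1 := ⟨b / 2, by omega⟩
  have hdvd : n ∣ c * (c + 1) := by
    have h1 := (Nat.modEq_iff_dvd' (by nlinarith)).1 h.symm
    have h2 : (2 * c + 1) ^ 2 - 1 = 4 * (c * (c + 1)) := by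
      rw [Nat.sub_eq_iff_eq_add (by nlinarith)]; ring
    rw [h2] at h1
    exact Nat.dvd_of_mul_dvd_mul_left (by norm_num) h1
  have hcop : Nat.Coprime c (c + 1) := by simp
  have hprod : n.gcd c * n.gcd (c + 1) = n := by
    rw [← Nat.Coprime.gcd_mul _ hcop]
    exact Nat.gcd_eq_left hdvd
  have hcop' : Nat.Coprime (n.gcd c) (n.gcd (c + 1)) :=
    hcop.coprime_dvd_left (Nat.gcd_dvd_right _ _) |>.coprime_dvd_right (Nat.gcd_dvd_right _ _)
  have hdA : n.gcd c ∣ c := Nat.gcd_dvd_right _ _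
  have hdB : n.gcd (c + 1) ∣ c + 1 := Nat.gcd_dvd_right _ _
  generalize n.gcd c = A at *
  generalize n.gcd (c + 1) = B at *
  -- Here `A B = n`; the extra factor `2` of `2 n` goes to `B` if `B` is even and to `A` otherwise,
  -- which preserves coprimality.
  by_cases hB : 2 ∣ B
  · have hA : ¬ 2 ∣ A := fun hA => by
      have := Nat.dvd_gcd hA hB
      rw [hcop'] at this
      omega
    refine ⟨A, 2 * B, by rw [← hprod]; ring, ?_, ?_, ?_, Or.inr ⟨hA, ?_⟩⟩
    · exact Nat.Coprime.mul_right ((Nat.Prime.coprime_iff_not_dvd Nat.prime_two).2 hA).symm hcop'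
    · simpa using hdA.mul_left 2
    · rw [show 2 * c + 1 + 1 = 2 * (c + 1) by ring]; exact mul_dvd_mul_left 2 hdB
    · obtain ⟨k, rfl⟩ := hB; exact ⟨k, by ring⟩
  · refine ⟨2 * A, B, by rw [← hprod]; ring, ?_, ?_, ?_, Or.inl ⟨⟨A, rfl⟩, hB⟩⟩
    · exact Nat.Coprime.mul_left ((Nat.Prime.coprime_iff_not_dvd Nat.prime_two).2 hB) hcop'
    · simpa using mul_dvd_mul_left 2 hdA
    · rw [show 2 * c + 1 + 1 = 2 * (c + 1) by ring]; exact hdB.mul_left 2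

/-- The parity rule for `1` and `b`, in terms of the factors of `2 n`: reduced fractions with
denominator `B` are farther from `1 / 4` than those with denominator `A`. -/
theorem abs_lt_of_parity {n b A B : ℕ} (hn : 0 < n) (hAB : A * B = 2 * n) (hcop : Nat.Coprime A B)
    (hA : A ∣ b - 1) (hb : 1 ≤ b) (hB : B ∣ b + 1)
    (hpar : ∀ l, Nat.Coprime l (2 * n) → 0 < sinPi n l * sinPi n (l * b))
    {u t : ℕ} (hu : Nat.Coprime u A) (ht : Nat.Coprime t B) (huA : 4 * u ≤ 2 * A) :
    |4 * (u : ℤ) - A| * B < |4 * (t : ℤ) - B| * A := by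
  have hA0 : 0 < A := Nat.pos_of_ne_zero (by rintro rfl; omega)
  have hB0 : 0 < B := Nat.pos_of_ne_zero (by rintro rfl; omega)
  -- By the Chinese remainder theorem `t A + u B` is a unit modulo `2 n = A B`. Its parts separate:
  -- modulo `2 n`, `l (b + 1) ≡ 2 u B` and `l (b - 1) ≡ -2 t A`.
  have hl : Nat.Coprime (t * A + u * B) (2 * n) := by
    rw [← hAB]
    apply Nat.Coprime.mul_right
    · rw [Nat.coprime_mul_right_add_left]
      exact Nat.Coprime.mul_left hu hcop.symm
    · rw [Nat.coprime_add_mul_right_left]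
      exact Nat.Coprime.mul_left ht hcop
  have hp := hpar _ hl
  obtain ⟨x, hx⟩ := hA
  obtain ⟨y, hy⟩ := hB
  have hA' : (A : ℝ) ≠ 0 := by exact_mod_cast hA0.ne'
  have hB' : (B : ℝ) ≠ 0 := by exact_mod_cast hB0.ne'
  have hn' : (n : ℝ) = A * B / 2 := by
    have : (A : ℝ) * B = 2 * n := by exact_mod_cast hAB
    linarith
  have hbx : (b : ℝ) = 1 + A * x := by
    have : b = 1 + A * x := by omega
    exact_mod_cast this
  have hby : (b : ℝ) = B * y - 1 := by
    have : (b : ℝ) + 1 = B * y := by exact_mod_cast hy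
    linarith
  -- Product to sum turns the two sines into cosines of `4πu/A` and `4πt/B`. Shifting each angle by
  -- `π` measures the distance of `u/A` and `t/B` from `1/4`.
  have e : sinPi n (t * A + u * B) * sinPi n ((t * A + u * B) * b)
      = (Real.cos (Real.pi * (4 * u - A) / A) - Real.cos (Real.pi * (4 * t - B) / B)) / 2 := by
    have e1 : Real.cos (Real.pi * ((t * A + u * B : ℕ) : ℝ) / n
        + Real.pi * (((t * A + u * B) * b : ℕ) : ℝ) / n)
        = Real.cos (Real.pi * (4 * u - A) / A + Real.pi) := by
      rw [← Real.cos_add_nat_mul_two_pi (Real.pi * (4 * u - A) / A + Real.pi) (t * y + u * x)]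
      congr 1
      push_cast
      have h1 : (b : ℝ) * (t * A + u * B) = (B * y - 1) * (t * A) + (1 + A * x) * (u * B) := by
        rw [← hby, ← hbx]; ring
      rw [hn']
      field_simp
      linear_combination 2 * h1
    have e2 : Real.cos (Real.pi * (((t * A + u * B) * b : ℕ) : ℝ) / n
        - Real.pi * ((t * A + u * B : ℕ) : ℝ) / n)
        = Real.cos (Real.pi * (4 * t - B) / B + Real.pi) := by
      rw [← Real.cos_neg (Real.pi * (4 * t - B) / B + Real.pi),
        ← Real.cos_add_nat_mul_two_pi (-(Real.pi * (4 * t - B) / B + Real.pi)) (t * y + u * x)]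
      congr 1
      push_cast
      have h1 : (b : ℝ) * (t * A + u * B) = (B * y - 1) * (t * A) + (1 + A * x) * (u * B) := by
        rw [← hby, ← hbx]; ring
      rw [hn']
      field_simp
      linear_combination 2 * h1
    rw [Real.cos_add_pi] at e1 e2
    rw [Real.cos_add] at e1
    rw [Real.cos_sub] at e2
    unfold sinPi
    linarith
  rw [e] at hp
  have hlt : Real.cos (Real.pi * (4 * t - B) / B) < Real.cos (Real.pi * (4 * u - A) / A) := by
    linarith
  by_contra hcon
  rw [not_lt] at hcon
  have hcon' : |4 * (t : ℝ) - B| * A ≤ |4 * (u : ℝ) - A| * B := by exact_mod_cast hcon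
  -- This puts the angle attached to `u` in `[0, π]`. In the contradictory case the other angle is
  -- no larger, so cosine is monotone on both.
  have huA' : |4 * (u : ℝ) - A| ≤ A := by
    have : (4 : ℝ) * u ≤ 2 * A := by exact_mod_cast huA
    rw [abs_le]; constructor <;> linarith [(Nat.cast_nonneg u : (0 : ℝ) ≤ u)]
  have hAp : (0 : ℝ) < A := by exact_mod_cast hA0
  have hBp : (0 : ℝ) < B := by exact_mod_cast hB0
  have habs : ∀ z w : ℝ, 0 < w → |Real.pi * z / w| = Real.pi * (|z| / w) := by
    intro z w hw
    rw [abs_div, abs_mul, abs_of_pos Real.pi_pos, abs_of_pos hw, mul_div_assoc]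
  rw [← Real.cos_abs, ← Real.cos_abs (Real.pi * (4 * u - A) / A), habs _ _ hAp, habs _ _ hBp] at hlt
  refine absurd hlt (not_lt.2 ?_)
  apply Real.cos_le_cos_of_nonneg_of_le_pi
  · have := Real.pi_pos; positivity
  · have : |4 * (u : ℝ) - A| / A ≤ 1 := (div_le_one hAp).2 huA'
    nlinarith [Real.pi_pos]
  · apply mul_le_mul_of_nonneg_left _ Real.pi_pos.le
    rw [div_le_div_iff₀ hBp hAp]
    exact hcon'

/-- The labels with the same parities as `1`, subject to the congruence from `T`. -/
theorem label_eq_of_parity {n b : ℕ} (hn : 3 ≤ n) (hb : 1 ≤ b) (hbn : b < n)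
    (h : b ^ 2 ≡ 1 [MOD 4 * n])
    (hpar : ∀ l, Nat.Coprime l (2 * n) → 0 < sinPi n l * sinPi n (l * b)) :
    b = 1 ∨ b = n - 1 ∨ (n = 12 ∧ b = 7) ∨ (n = 30 ∧ (b = 11 ∨ b = 19)) := by
  obtain ⟨A, B, hAB, hcop, hA, hB, hpr⟩ := exists_coprime_split hb h
  have key : ∀ {u t : ℕ}, Nat.Coprime u A → Nat.Coprime t B → 4 * u ≤ 2 * A →
      |4 * (u : ℤ) - A| * B < |4 * (t : ℤ) - B| * A :=
    fun hu ht huA => abs_lt_of_parity (by omega) hAB hcop hA hb hB hpar hu ht huA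
  have hA0 : 0 < A := Nat.pos_of_ne_zero (by rintro rfl; omega)
  have hB0 : 0 < B := Nat.pos_of_ne_zero (by rintro rfl; omega)
  rcases hpr with ⟨hA2, hB2⟩ | ⟨hA2, hB4⟩
  · rcases Nat.lt_or_ge 1 B with hB1 | hB1
    -- For odd `B` take `t` to be the integer nearest to `B/4`. With `u = 1` the inequality reads
    -- `|4 - A| B < A`, and for even `A` and `B ≥ 3` it leaves only `A = 4`.
    · obtain ⟨t, ht, ht'⟩ : ∃ t : ℕ, Nat.Coprime t B ∧ |4 * (t : ℤ) - B| = 1 := by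
        obtain ⟨q, hq⟩ : ∃ q, B = 4 * q + 1 ∨ B + 1 = 4 * q := ⟨(B + 1) / 4, by omega⟩
        refine ⟨q, ?_, ?_⟩
        · rcases hq with hq | hq
          · rw [hq]; simp
          · have h1 : Nat.Coprime q (B + 1 - 1) := by
              rw [hq]
              obtain ⟨r, rfl⟩ : ∃ r, q = r + 1 := ⟨q - 1, by omega⟩
              rw [show 4 * (r + 1) - 1 = 3 * (r + 1) + r by omega]
              simp
            simpa using h1
        · rcases hq with hq | hq
          · rw [show (4 * (q : ℤ) - B) = -1 by omega]; rfl
          · rw [show (4 * (q : ℤ) - B) = 1 by omega]; rfl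
      have hk := key (u := 1) (by simp) ht (by omega)
      rw [ht'] at hk
      rcases Nat.lt_or_ge A 4 with h4 | h4
      · obtain rfl : A = 2 := by omega
        norm_num at hk
        omega
      · rcases Nat.eq_or_lt_of_le h4 with h5 | h5
        · subst h5
          right; left
          have hn2 : n = 2 * B := by omega
          obtain ⟨k, hk'⟩ := hB
          have : k < 3 := by
            by_contra hk3
            have : B * 3 ≤ B * k := Nat.mul_le_mul_left _ (by omega)
            omega
          interval_cases k <;> omega
        · exfalso
          rw [abs_of_nonpos (by push_cast; omega)] at hk
          have hA6 : 6 ≤ A := by omega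
          have hB3 : 3 ≤ B := by omega
          have h7 : A ≠ 6 ∨ 4 ≤ B := by
            by_contra hc
            have h8 : A = 6 := by omega
            have h9 : B = 3 := by omega
            rw [h8, h9] at hcop
            norm_num at hcop
          push_cast at hk
          have hA6' : (6 : ℤ) ≤ A := by exact_mod_cast hA6
          have hB3' : (3 : ℤ) ≤ B := by exact_mod_cast hB3
          rcases h7 with h7 | h7
          · have : (7 : ℤ) ≤ A := by omega
            nlinarith
          · have : (4 : ℤ) ≤ B := by omega
            nlinarith
    · left
      obtain rfl : B = 1 := by omega
      have : A = 2 * n := by omega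
      rw [this] at hA
      by_contra hb1
      have := Nat.le_of_dvd (by omega) hA
      omega
  · rcases Nat.lt_or_ge 1 A with hA1 | hA1
    · have hA3 : 3 ≤ A := by omega
      -- The numerator `(A - 1)/2` puts `u/A` as far beyond `1/4` as the bound `4 u ≤ 2 A` permits.
      obtain ⟨u, hu⟩ : ∃ u, A = 2 * u + 1 := ⟨A / 2, by omega⟩
      have hcu : Nat.Coprime u A := by rw [hu]; simp
      have huA : |4 * (u : ℤ) - A| = A - 2 := by
        rw [abs_of_nonneg (by omega)]; omega
      obtain ⟨c, hc⟩ := hB4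
      have hA3' : (3 : ℤ) ≤ A := by exact_mod_cast hA3
      -- With `B = 4 c`, an admissible numerator close to `B/4` is `c - 1` for even `c` and `c - 2`
      -- for odd `c ≥ 3`; for `c = 1`, `t = 1` gives `1/4` exactly, which is impossible. The
      -- inequalities become `(A - 2) B < 4 A` with `B ≥ 8`, and `(A - 2) B < 8 A` with `B ≥ 12`.
      -- The coprime solutions are `(A, B) = (3, 8)`, then `(3, 20)` and `(5, 12)`, giving `b = 7`,
      -- `19` and `11`.
      rcases Nat.even_or_odd' c with ⟨d, hd | hd⟩
      · have ht : Nat.Coprime (c - 1) B := by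
          rw [hc, hd]
          have e : 2 * d = (2 * d - 1) + 1 := by omega
          apply Nat.Coprime.mul_right
          · rw [show 4 = 2 ^ 2 by norm_num]
            apply Nat.Coprime.pow_right
            rw [Nat.coprime_comm, Nat.Prime.coprime_iff_not_dvd Nat.prime_two]
            omega
          · nth_rewrite 2 [e]; simp
        have hk := key hcu ht (by omega)
        rw [huA, show (4 * ((c - 1 : ℕ) : ℤ) - B) = -4 by omega] at hk
        norm_num at hk
        have hB8 : (8 : ℤ) ≤ B := by omega
        have hAlt : (A : ℤ) < 4 := by nlinarith
        obtain rfl : A = 3 := by omega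
        have hd1 : d = 1 := by push_cast at hk; omega
        right; right; left
        subst hd1
        have : B = 8 := by omega
        subst this
        omega
      · rcases Nat.eq_zero_or_pos d with hd0 | hd0
        · exfalso
          have hB : B = 4 := by omega
          subst hB
          have hk := key (t := 1) hcu (by simp) (by omega)
          rw [huA] at hk
          norm_num at hk
          omega
        · have ht : Nat.Coprime (c - 2) B := by
            rw [hc, hd]
            have e : 2 * d + 1 = 2 + (2 * d + 1 - 2) := by omega
            have h2 : Nat.Coprime (2 * d + 1 - 2) 2 := by
              rw [Nat.coprime_comm, Nat.Prime.coprime_iff_not_dvd Nat.prime_two]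
              omega
            apply Nat.Coprime.mul_right
            · rw [show 4 = 2 ^ 2 by norm_num]
              exact Nat.Coprime.pow_right _ h2
            · nth_rewrite 2 [e]; simpa using h2
          have hk := key hcu ht (by omega)
          rw [huA, show (4 * ((c - 2 : ℕ) : ℤ) - B) = -8 by omega] at hk
          norm_num at hk
          have hB12 : (12 : ℤ) ≤ B := by omega
          have hAlt : (A : ℤ) < 6 := by nlinarith
          have hA5 : A = 3 ∨ A = 5 := by omega
          rcases hA5 with rfl | rfl
          · have hd1 : d = 1 ∨ d = 2 := by push_cast at hk; omega
            rcases hd1 with rfl | rfl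
            · have : B = 12 := by omega
              subst this
              norm_num at hcop
            · have : B = 20 := by omega
              subst this
              omega
          · have hd1 : d = 1 := by push_cast at hk; omega
            subst hd1
            have : B = 12 := by omega
            subst this
            omega
    · exfalso
      obtain rfl : A = 1 := by omega
      have : B = 2 * n := by omega
      rw [this] at hB
      have := Nat.le_of_dvd (by omega) hB
      omega

/-! ### Trivial first row: the `A` series and the permutation `D` series -/

theorem sinPi_two_mul_ne_zero {n a : ℕ} (ha : 1 ≤ a) (ha' : a < n) (h : 2 * a ≠ n) :
    sinPi n (2 * a) ≠ 0 := by
  rcases lt_or_gt_of_ne h with h1 | h1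
  · exact (sinPi_pos (by omega) h1).ne'
  · have h2 := sinPi_two_mul_sub (n := n) (k := 2 * a) (by omega) (by omega)
    have h3 := sinPi_pos (n := n) (k := 2 * n - 2 * a) (by omega) (by omega)
    intro h4
    rw [h2, h4, neg_zero] at h3
    exact lt_irrefl _ h3

theorem add_le_sum_of_ne {ι : Type*} {s : Finset ι} {f : ι → ℝ} {i j : ι} (hij : i ≠ j)
    (hi : i ∈ s) (hj : j ∈ s) (hf : ∀ k ∈ s, 0 ≤ f k) : f i + f j ≤ ∑ k ∈ s, f k := by
  classical
  rw [← sum_pair hij]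
  exact sum_le_sum_of_subset_of_nonneg (by simp [insert_subset_iff, hi, hj]) fun k hk _ => hf k hk

theorem add_add_le_sum_of_ne {ι : Type*} {s : Finset ι} {f : ι → ℝ} {i j l : ι} (hij : i ≠ j)
    (hil : i ≠ l) (hjl : j ≠ l) (hi : i ∈ s) (hj : j ∈ s) (hl : l ∈ s) (hf : ∀ k ∈ s, 0 ≤ f k) :
    f i + f j + f l ≤ ∑ k ∈ s, f k := by
  classical
  rw [add_assoc, ← sum_pair hjl, ← sum_insert (by simp [hij, hil])]
  exact sum_le_sum_of_subset_of_nonneg (by simp [insert_subset_iff, hi, hj, hl])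
    fun k hk _ => hf k hk

/-- A sum over the labels of a function supported on two labels. -/
theorem sum_label_eq_add {n i j : ℕ} (hij : i ≠ j) (hi : 1 ≤ i) (hi' : i < n) (hj : 1 ≤ j)
    (hj' : j < n) {f : ℕ → ℝ} (hf : ∀ k, 1 ≤ k → k < n → k ≠ i → k ≠ j → f k = 0) :
    ∑ k ∈ Ico 1 n, f k = f i + f j := by
  rw [← sum_pair hij]
  symm
  apply sum_subset
  · simp [insert_subset_iff, *]
  · intro k hk hk'
    simp only [mem_insert, mem_singleton, not_or] at hk'
    exact hf k (mem_Ico.1 hk).1 (mem_Ico.1 hk).2 hk'.1 hk'.2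

/-- A sum over the labels of a function supported on one label. -/
theorem sum_label_eq {n i : ℕ} (hi : 1 ≤ i) (hi' : i < n) {f : ℕ → ℝ}
    (hf : ∀ k, 1 ≤ k → k < n → k ≠ i → f k = 0) : ∑ k ∈ Ico 1 n, f k = f i :=
  sum_eq_single_of_mem i (by simp [*]) fun k hk hki =>
    hf k (mem_Ico.1 hk).1 (mem_Ico.1 hk).2 hki

namespace IsInvariantTable

variable {n : ℕ} {m : ℕ → ℕ → ℕ}

theorem row_one_support (h : IsInvariantTable n m) (hn : 3 ≤ n) {b : ℕ} (hb : 1 ≤ b) (hbn : b < n)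
    (hb1 : m 1 b ≠ 0) :
    b = 1 ∨ b = n - 1 ∨ (n = 12 ∧ b = 7) ∨ (n = 30 ∧ (b = 11 ∨ b = 19)) := by
  refine label_eq_of_parity hn hb hbn ?_ fun l hl => ?_
  · simpa using (h.sq_modEq 1 b le_rfl (by omega) hb hbn hb1).symm
  · simpa using h.sinPi_galois_pos hl le_rfl (by omega) hb hbn hb1

theorem sinPi_nonneg_of_mem {c : ℕ} (hc : c ∈ Ico 1 n) : 0 ≤ sinPi n c :=
  (sinPi_pos (mem_Ico.1 hc).1 (mem_Ico.1 hc).2).le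

/-- A column that is orthogonal to the first row of `S` vanishes. -/
theorem col_eq_zero {a b : ℕ} (ha : 1 ≤ a) (ha' : a < n)
    (h0 : ∑ c ∈ Ico 1 n, sinPi n c * (m c b : ℝ) = 0) : m a b = 0 := by
  rw [sum_eq_zero_iff_of_nonneg fun c hc => mul_nonneg (sinPi_nonneg_of_mem hc) (Nat.cast_nonneg _)] at h0
  have h1 := h0 a (by simp [*])
  have := (mul_eq_zero.1 h1).resolve_left (sinPi_pos ha ha').ne'
  exact_mod_cast this

/-- Row and column sums weighted by `sin(πc/n)` reproduce the weight itself. A nonzero entry at `(a,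
b)` thus gives inequalities between the weights of `a` and `b` in both directions, so the weights
agree and the entry is `1`; a second nonzero entry would double the row sum. -/
theorem perm_row (h : IsInvariantTable n m)
    (hrow : ∀ b, 1 ≤ b → b < n → b ≠ 1 → m 1 b = 0) (hcol : ∀ a, 1 ≤ a → a < n → a ≠ 1 → m a 1 = 0)
    {a : ℕ} (ha : 1 ≤ a) (ha' : a < n) :
    ∃ b, 1 ≤ b ∧ b < n ∧ (b = a ∨ b = n - a) ∧ m a b = 1 ∧
      ∀ c, 1 ≤ c → c < n → c ≠ b → m a c = 0 := by
  have hcolsum : ∀ b, 1 ≤ b → b < n → ∑ c ∈ Ico 1 n, sinPi n c * (m c b : ℝ) = sinPi n b := by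
    intro b hb hb'
    have h1 := h.comm 1 b le_rfl (by omega) hb hb'
    rw [sum_label_eq le_rfl (by omega) (fun k hk hk' hk1 => by simp [hrow k hk hk' hk1]),
      h.one_one] at h1
    simpa using h1.symm
  have hrowsum : ∀ a, 1 ≤ a → a < n → ∑ c ∈ Ico 1 n, sinPi n c * (m a c : ℝ) = sinPi n a := by
    intro a ha ha'
    have h1 := h.comm a 1 ha ha' le_rfl (by omega)
    rw [sum_label_eq (f := fun c => sinPi n (a * c) * (m c 1 : ℝ)) le_rfl (by omega)
      (fun k hk hk' hk1 => by simp [hcol k hk hk' hk1]), h.one_one] at h1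
    simpa [mul_comm] using h1
  have hle : ∀ b, 1 ≤ b → b < n → m a b ≠ 0 → sinPi n a = sinPi n b ∧ m a b = 1 := by
    intro b hb hb' hab
    have pa := sinPi_pos ha ha'
    have pb := sinPi_pos hb hb'
    have h1 : sinPi n a * (m a b : ℝ) ≤ sinPi n b := by
      rw [← hcolsum b hb hb']
      exact single_le_sum (f := fun c => sinPi n c * (m c b : ℝ))
        (fun c hc => mul_nonneg (sinPi_nonneg_of_mem hc) (Nat.cast_nonneg _)) (by simp [*])
    have h2 : sinPi n b * (m a b : ℝ) ≤ sinPi n a := by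
      rw [← hrowsum a ha ha']
      exact single_le_sum (f := fun c => sinPi n c * (m a c : ℝ))
        (fun c hc => mul_nonneg (sinPi_nonneg_of_mem hc) (Nat.cast_nonneg _)) (by simp [*])
    have h3 : (1 : ℝ) ≤ m a b := by exact_mod_cast Nat.one_le_iff_ne_zero.2 hab
    have h4 : sinPi n a = sinPi n b := by nlinarith
    refine ⟨h4, ?_⟩
    rw [h4] at h2
    have h5 : (m a b : ℝ) ≤ 1 := by nlinarith
    have h6 : m a b ≤ 1 := by exact_mod_cast h5
    omega
  obtain ⟨b, hb, hb', hab⟩ : ∃ b, 1 ≤ b ∧ b < n ∧ m a b ≠ 0 := by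
    by_contra! hcon
    have h1 := hrowsum a ha ha'
    rw [sum_eq_zero fun c hc => by simp [hcon c (mem_Ico.1 hc).1 (mem_Ico.1 hc).2]] at h1
    exact absurd h1 (sinPi_pos ha ha').ne
  refine ⟨b, hb, hb', sinPi_eq_imp ha' hb' (hle b hb hb' hab).1, (hle b hb hb' hab).2, ?_⟩
  intro c hc hc' hcb
  by_contra hac
  have h1 := add_le_sum_of_ne (f := fun c => sinPi n c * (m a c : ℝ)) (i := c) (j := b)
    (s := Ico 1 n) hcb (by simp [*]) (by simp [*])
    (fun c hc => mul_nonneg (sinPi_nonneg_of_mem hc) (Nat.cast_nonneg _))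
  rw [hrowsum a ha ha', (hle b hb hb' hab).2, (hle c hc hc' hac).2, ← (hle b hb hb' hab).1,
    ← (hle c hc hc' hac).1] at h1
  have := sinPi_pos ha ha'
  norm_num at h1
  linarith

/-- If the first row and column are trivial, the table is that of the identity or of the
permutation fixing the odd labels and exchanging each even label `a` with `n - a`. -/
theorem eq_of_trivial_row (h : IsInvariantTable n m) (hn : 3 ≤ n)
    (hrow : ∀ b, 1 ≤ b → b < n → b ≠ 1 → m 1 b = 0)
    (hcol : ∀ a, 1 ≤ a → a < n → a ≠ 1 → m a 1 = 0) :
    (∀ a b, 1 ≤ a → a < n → 1 ≤ b → b < n → m a b = if b = a then 1 else 0) ∨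
    (n % 4 = 0 ∧ ∀ a b, 1 ≤ a → a < n → 1 ≤ b → b < n →
      m a b = if b = (if a % 2 = 1 then a else n - a) then 1 else 0) := by
  have hR := fun a (ha : 1 ≤ a ∧ a < n) => h.perm_row hrow hcol ha.1 ha.2
  choose! π hπ1 hπn hπ hπm hπ0 using hR
  obtain ⟨r, hr1, hrn, hr, hrm, hr0⟩ :=
    h.transpose.perm_row hcol hrow (a := 2) (by omega) (by omega)
  -- Commutation against column `2` decides everything: the labels `a` and `n - a` have opposite
  -- sines at `2`, so the one value `r` fixes each choice.
  have hcomm : ∀ a, 1 ≤ a → a < n → sinPi n (2 * π a) = sinPi n (a * r) := by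
    intro a ha ha'
    have h1 := h.comm a 2 ha ha' (by omega) (by omega)
    rw [sum_label_eq (hπ1 a ⟨ha, ha'⟩) (hπn a ⟨ha, ha'⟩)
        (fun k hk hk' hk1 => by simp [hπ0 a ⟨ha, ha'⟩ k hk hk' hk1]),
      sum_label_eq (f := fun c => sinPi n (a * c) * (m c 2 : ℝ)) hr1 hrn
        (fun k hk hk' hk1 => by simp [hr0 k hk hk' hk1]), hπm a ⟨ha, ha'⟩, hrm] at h1
    simpa [mul_comm] using h1
  have hentry : ∀ (σ : ℕ → ℕ), (∀ a, 1 ≤ a → a < n → π a = σ a) →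
      ∀ a b, 1 ≤ a → a < n → 1 ≤ b → b < n → m a b = if b = σ a then 1 else 0 := by
    intro σ hσ a b ha ha' hb hb'
    rw [← hσ a ha ha']
    split_ifs with hba
    · rw [hba, hπm a ⟨ha, ha'⟩]
    · exact hπ0 a ⟨ha, ha'⟩ b hb hb' hba
  have hfix : ∀ a, 1 ≤ a → a < n → sinPi n (2 * π a) = sinPi n (2 * a) → π a = a := by
    intro a ha ha' he
    rcases hπ a ⟨ha, ha'⟩ with h1 | h1
    · exact h1
    · by_cases h2 : 2 * a = n
      · omega
      · exfalso
        rw [h1, sinPi_mul_sub (by omega) ha'.le] at he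
        refine sinPi_two_mul_ne_zero ha ha' h2 ?_
        norm_num at he
        linarith
  have hflip : ∀ a, 1 ≤ a → a < n → sinPi n (2 * π a) = -sinPi n (2 * a) → π a = n - a := by
    intro a ha ha' he
    rcases hπ a ⟨ha, ha'⟩ with h1 | h1
    · by_cases h2 : 2 * a = n
      · omega
      · exfalso
        rw [h1] at he
        refine sinPi_two_mul_ne_zero ha ha' h2 ?_
        linarith
    · exact h1
  by_cases hr2 : r = 2
  · left
    refine hentry id fun a ha ha' => hfix a ha ha' ?_
    rw [hcomm a ha ha', hr2, mul_comm]
  · right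
    have hr' : r = n - 2 := by tauto
    -- Pairing `2` with `n - 2` needs `4 n ∣ (n - 2)² - 4 = n (n - 4)`.
    have h4 : n % 4 = 0 := by
      have h1 := (h.sq_modEq r 2 hr1 hrn (by omega) (by omega) (by rw [hrm]; norm_num)).symm
      rw [hr', ← Int.natCast_modEq_iff, Int.modEq_iff_dvd] at h1
      push_cast [Nat.cast_sub (by omega : 2 ≤ n)] at h1
      have h2 : ((n : ℤ) - 2) ^ 2 - 4 = n * (n - 4) := by ring
      rw [h2, mul_comm 4] at h1
      have h3 := Int.dvd_of_mul_dvd_mul_left (by omega : (n : ℤ) ≠ 0) h1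
      omega
    refine ⟨h4, hentry (fun a => if a % 2 = 1 then a else n - a) fun a ha ha' => ?_⟩
    have h1 := hcomm a ha ha'
    rw [hr', sinPi_mul_sub (by omega) (by omega), mul_comm a 2] at h1
    split_ifs with hodd
    · apply hfix a ha ha'
      rw [h1, Even.neg_one_pow (by rw [Nat.even_iff]; omega), one_mul]
    · apply hflip a ha ha'
      rw [h1, Odd.neg_one_pow (by rw [Nat.odd_iff]; omega), neg_one_mul]

end IsInvariantTable

/-! ### First row supported on `1` and `n - 1`: the block `D` series and `E₇` -/

/-- The table of `(∑_{a ∈ s} χ_a) (∑_{b ∈ t} χ_b)^*`. -/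
def blockTable (s t : Finset ℕ) (a b : ℕ) : ℕ := if a ∈ s ∧ b ∈ t then 1 else 0

/-- The table of `E₆`. -/
def tableE6 (a b : ℕ) : ℕ :=
  blockTable {1, 7} {1, 7} a b + blockTable {4, 8} {4, 8} a b + blockTable {5, 11} {5, 11} a b

/-- The table of `E₇`. -/
def tableE7 (a b : ℕ) : ℕ :=
  blockTable {1, 17} {1, 17} a b + blockTable {5, 13} {5, 13} a b
    + blockTable {7, 11} {7, 11} a b + blockTable {9} {3, 15} a b + blockTable {3, 15} {9} a b
    + blockTable {9} {9} a b

/-- The table of `E₈`. -/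
def tableE8 (a b : ℕ) : ℕ :=
  blockTable {1, 11, 19, 29} {1, 11, 19, 29} a b
    + blockTable {7, 13, 17, 23} {7, 13, 17, 23} a b

theorem sinPi_half {n f : ℕ} (hf : n = 2 * f) (hn : 0 < n) : sinPi n f = 1 := by
  have hf0 : (f : ℝ) ≠ 0 := by exact_mod_cast (by omega : f ≠ 0)
  unfold sinPi
  rw [← Real.sin_pi_div_two]
  congr 1
  rw [hf]
  push_cast
  field_simp

theorem sinPi_eq_half_imp {n a : ℕ} (ha : 1 ≤ a) (han : a < n) (h : sinPi n a = 1 / 2) :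
    n = 6 * a ∨ n = 6 * (n - a) := by
  have hn0 : (n : ℝ) ≠ 0 := by exact_mod_cast (by omega : n ≠ 0)
  unfold sinPi at h
  rw [← Real.sin_pi_div_six, Real.sin_eq_sin_iff] at h
  obtain ⟨k, hk | hk⟩ := h
  · have h1 : (n : ℝ) = 12 * k * n + 6 * a := by
      field_simp at hk
      nlinarith [Real.pi_pos]
    have h2 : (n : ℤ) = 12 * k * n + 6 * a := by exact_mod_cast h1
    left
    rcases lt_trichotomy k 0 with hk0 | hk0 | hk0
    · nlinarith
    · subst hk0; omega
    · nlinarith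
  · have h1 : (n : ℝ) = 6 * (2 * k + 1) * n - 6 * a := by
      field_simp at hk
      nlinarith [Real.pi_pos]
    have h2 : (n : ℤ) = 6 * (2 * k + 1) * n - 6 * a := by exact_mod_cast h1
    right
    rcases lt_trichotomy k 0 with hk0 | hk0 | hk0
    · nlinarith
    · subst hk0; omega
    · nlinarith

/-- This is `M = S M S`, a consequence of commutation and `S² = 1`; it lets an entry be read off
from a subset of the columns. -/
theorem IsInvariantTable.entry_eq {n : ℕ} {m : ℕ → ℕ → ℕ} (h : IsInvariantTable n m) {a d : ℕ}
    (ha : 1 ≤ a) (ha' : a < n) (hd : 1 ≤ d) (hd' : d < n) :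
    (m a d : ℝ) * (n / 2)
      = ∑ b ∈ Ico 1 n, (∑ c ∈ Ico 1 n, sinPi n (a * c) * (m c b : ℝ)) * sinPi n (b * d) := by
  calc (m a d : ℝ) * (n / 2) = ∑ c ∈ Ico 1 n, (m a c : ℝ) *
        ∑ b ∈ Ico 1 n, sinPi n (c * b) * sinPi n (b * d) := by
        rw [sum_label_eq hd hd' fun c hc hc' hcd => by
          rw [sum_sinPi_mul_sinPi hc hc' hd hd', if_neg hcd, mul_zero],
          sum_sinPi_mul_sinPi hd hd' hd hd', if_pos rfl]
    _ = ∑ b ∈ Ico 1 n, (∑ c ∈ Ico 1 n, (m a c : ℝ) * sinPi n (c * b)) * sinPi n (b * d) := by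
        simp only [sum_mul, mul_sum]
        rw [sum_comm]
        simp only [mul_assoc]
    _ = _ := by
        refine sum_congr rfl fun b hb => ?_
        rw [h.comm a b ha ha' (mem_Ico.1 hb).1 (mem_Ico.1 hb).2]

/-- If the even columns vanish then the columns of `b` and `n - b` agree. -/
theorem IsInvariantTable.col_sub {n : ℕ} {m : ℕ → ℕ → ℕ} (h : IsInvariantTable n m)
    (heven : ∀ a b, 1 ≤ a → a < n → 1 ≤ b → b < n → b % 2 = 0 → m a b = 0) {a b : ℕ}
    (ha : 1 ≤ a) (ha' : a < n) (hb : 1 ≤ b) (hb' : b < n) : m a (n - b) = m a b := by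
  have hn0 : (n : ℝ) ≠ 0 := by exact_mod_cast (by omega : n ≠ 0)
  have h1 : (m a (n - b) : ℝ) * (n / 2) = m a b * (n / 2) := by
    rw [h.entry_eq ha ha' (by omega) (by omega), h.entry_eq ha ha' hb hb']
    refine sum_congr rfl fun d hd => ?_
    have hd := mem_Ico.1 hd
    rcases Nat.mod_two_eq_zero_or_one d with h0 | h0
    · rw [sum_eq_zero fun c hc => by
        rw [heven c d (mem_Ico.1 hc).1 (mem_Ico.1 hc).2 hd.1 hd.2 h0]; simp]
      simp
    · rw [sinPi_mul_sub (by omega) hb'.le, Even.neg_one_pow (by rw [Nat.even_iff]; omega), one_mul]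
  have h2 := mul_right_cancel₀ (by positivity) h1
  exact_mod_cast h2

/-- An invariant table whose first row and column are supported on `1` and `n - 1`, with
entries `1` there. -/
structure IsSimpleCurrentExtension (n : ℕ) (m : ℕ → ℕ → ℕ) : Prop where
  table : IsInvariantTable n m
  six_le : 6 ≤ n
  mod_four : n % 4 = 2
  row : m 1 (n - 1) = 1
  row_zero : ∀ b, 1 ≤ b → b < n → b ≠ 1 → b ≠ n - 1 → m 1 b = 0
  col : m (n - 1) 1 = 1
  col_zero : ∀ a, 1 ≤ a → a < n → a ≠ 1 → a ≠ n - 1 → m a 1 = 0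

namespace IsSimpleCurrentExtension

variable {n : ℕ} {m : ℕ → ℕ → ℕ}

theorem transpose (h : IsSimpleCurrentExtension n m) :
    IsSimpleCurrentExtension n fun a b => m b a :=
  ⟨h.table.transpose, h.six_le, h.mod_four, h.col, h.col_zero, h.row, h.row_zero⟩

theorem col_sum (h : IsSimpleCurrentExtension n m) {b : ℕ} (hb : 1 ≤ b) (hb' : b < n) :
    ∑ c ∈ Ico 1 n, sinPi n c * (m c b : ℝ) = (1 + (-1) ^ (b + 1)) * sinPi n b := by
  have hn := h.six_le
  have h1 := h.table.comm 1 b le_rfl (by omega) hb hb'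
  rw [sum_label_eq_add (i := 1) (j := n - 1) (by omega) le_rfl (by omega) (by omega) (by omega)
    (fun k hk hk' hk1 hk2 => by simp [h.row_zero k hk hk' hk1 hk2]), h.table.one_one, h.row,
    sinPi_sub_mul (by omega) (by omega)] at h1
  simp only [one_mul, Nat.cast_one] at h1
  rw [← h1]
  ring

/-- For even `b` the contributions of `1` and `n - 1` cancel, so the positively weighted column sum
is zero. -/
theorem entry_even (h : IsSimpleCurrentExtension n m) {a b : ℕ} (ha : 1 ≤ a) (ha' : a < n)
    (hb : 1 ≤ b) (hb' : b < n) (hb2 : b % 2 = 0) : m a b = 0 := by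
  apply IsInvariantTable.col_eq_zero ha ha'
  rw [h.col_sum hb hb', Odd.neg_one_pow (by rw [Nat.odd_iff]; omega)]
  simp

theorem col_sum_odd (h : IsSimpleCurrentExtension n m) {b : ℕ} (hb : 1 ≤ b) (hb' : b < n)
    (hb2 : b % 2 = 1) : ∑ c ∈ Ico 1 n, sinPi n c * (m c b : ℝ) = 2 * sinPi n b := by
  rw [h.col_sum hb hb', Even.neg_one_pow (by rw [Nat.even_iff]; omega)]
  norm_num

theorem entry_sub (h : IsSimpleCurrentExtension n m) {a b : ℕ} (ha : 1 ≤ a) (ha' : a < n)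
    (hb : 1 ≤ b) (hb' : b < n) : m a (n - b) = m a b :=
  h.table.col_sub (fun _ _ ha ha' hb hb' => h.entry_even ha ha' hb hb') ha ha' hb hb'

/-- The distinct labels `a` and `n - a` have equal entries and equal weights, so they take twice one
contribution out of the total `2 sin(πb/n)`. -/
theorem two_mul_le (h : IsSimpleCurrentExtension n m) {a b : ℕ} (ha : 1 ≤ a) (ha' : a < n)
    (hb : 1 ≤ b) (hb' : b < n) (haf : 2 * a ≠ n) (hb2 : b % 2 = 1) :
    sinPi n a * (m a b : ℝ) ≤ sinPi n b := by
  have h1 := add_le_sum_of_ne (f := fun c => sinPi n c * (m c b : ℝ)) (i := a) (j := n - a)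
    (s := Ico 1 n) (by omega) (by simp [*]) (by simp; omega)
    (fun c hc => mul_nonneg (IsInvariantTable.sinPi_nonneg_of_mem hc) (Nat.cast_nonneg _))
  have h2 : m (n - a) b = m a b := h.transpose.entry_sub hb hb' ha ha'
  simp only [h2, sinPi_sub (by omega : 0 < n) ha'.le] at h1
  rw [h.col_sum_odd hb hb' hb2] at h1
  linarith

/-- A nonzero entry off the middle label forces equal weights, and then `b` and `n - b` exhaust the
column sum. Otherwise the column lives on `f = n/2`, of weight `1`, so `m f b = 2 sin(πb/n)`; the
transposed bound `m f b * sin(πb/n) ≤ 1` makes this integer `1`, so the sine is `1/2`. -/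
theorem col_dichotomy (h : IsSimpleCurrentExtension n m) {b : ℕ} (hb : 1 ≤ b) (hb' : b < n)
    (hb2 : b % 2 = 1) (hbf : 2 * b ≠ n) :
    (m b b = 1 ∧ m (n - b) b = 1 ∧ ∀ c, 1 ≤ c → c < n → c ≠ b → c ≠ n - b → m c b = 0) ∨
    ((n = 6 * b ∨ n = 6 * (n - b)) ∧ ∀ c, 1 ≤ c → c < n → m c b = if 2 * c = n then 1 else 0) := by
  have hn := h.six_le
  have hn4 := h.mod_four
  by_cases hex : ∃ a, 1 ≤ a ∧ a < n ∧ 2 * a ≠ n ∧ m a b ≠ 0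
  · left
    obtain ⟨a, ha, ha', haf, hab⟩ := hex
    have ha2 : a % 2 = 1 := by
      by_contra hcon
      exact hab (h.transpose.entry_even hb hb' ha ha' (by omega))
    have h1 := h.two_mul_le ha ha' hb hb' haf hb2
    have h2 : sinPi n b * (m a b : ℝ) ≤ sinPi n a := h.transpose.two_mul_le hb hb' ha ha' hbf ha2
    have pa := sinPi_pos ha ha'
    have pb := sinPi_pos hb hb'
    have h3 : (1 : ℝ) ≤ m a b := by exact_mod_cast Nat.one_le_iff_ne_zero.2 hab
    have h4 : sinPi n a = sinPi n b := by nlinarith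
    have h5 : m a b = 1 := by
      rw [h4] at h2 h1
      have h5 : (m a b : ℝ) ≤ 1 := by nlinarith
      have h6 : m a b ≤ 1 := by exact_mod_cast h5
      omega
    have hJ : m (n - a) b = m a b := h.transpose.entry_sub hb hb' ha ha'
    have hJb : m (n - b) b = m b b := h.transpose.entry_sub hb hb' hb hb'
    have hbb : m b b = 1 := by
      rcases sinPi_eq_imp ha' hb' h4 with e | e
      · rw [e] at h5 ⊢; exact h5
      · rw [h5, ← e] at hJ; exact hJ
    refine ⟨hbb, hJb.trans hbb, fun c hc hc' hcb hcb' => ?_⟩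
    have h6 := add_add_le_sum_of_ne (f := fun c => sinPi n c * (m c b : ℝ)) (i := b) (j := n - b)
      (l := c) (s := Ico 1 n) (by omega) (by omega) (by omega) (by simp [*]) (by simp; omega)
      (by simp [*])
      (fun c hc => mul_nonneg (IsInvariantTable.sinPi_nonneg_of_mem hc) (Nat.cast_nonneg _))
    simp only [hJb, hbb, sinPi_sub (by omega : 0 < n) hb'.le, h.col_sum_odd hb hb' hb2] at h6
    have h7 := sinPi_pos hc hc'
    have h8 : (0 : ℝ) ≤ m c b := Nat.cast_nonneg _
    have h9 : (m c b : ℝ) = 0 := by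
      apply le_antisymm _ h8
      push_cast at h6
      nlinarith
    exact_mod_cast h9
  · right
    push Not at hex
    obtain ⟨f, hf⟩ : ∃ f, n = 2 * f := ⟨n / 2, by omega⟩
    have h1 := h.col_sum_odd hb hb' hb2
    rw [sum_label_eq (i := f) (by omega) (by omega) (fun c hc hc' hcf => by
      rw [hex c hc hc' (by omega)]; simp), sinPi_half hf (by omega), one_mul] at h1
    have h2 : sinPi n b * (m f b : ℝ) ≤ sinPi n f :=
      h.transpose.two_mul_le hb hb' (by omega) (by omega) hbf (by omega)
    rw [sinPi_half hf (by omega)] at h2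
    have pb := sinPi_pos hb hb'
    have h3 : m f b = 1 := by
      have h4 : m f b ≠ 0 := by
        intro h0
        rw [h0] at h1
        norm_num at h1
        linarith
      have h5 : m f b < 2 := by
        by_contra hcon
        have h6 : (2 : ℝ) ≤ m f b := by exact_mod_cast not_lt.1 hcon
        nlinarith
      omega
    refine ⟨sinPi_eq_half_imp hb hb' ?_, fun c hc hc' => ?_⟩
    · rw [h3] at h1
      norm_num at h1
      linarith
    · split_ifs with hcf
      · rw [show c = f by omega, h3]
      · exact hex c hc hc' hcf

/-- The `T` condition between `3 a` and `a` gives `3 ∣ a`. If `n ≠ 18`, row `3` is of the ordinary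
type, supported on `3` and `n - 3`, and commutation at `(3, a)` then reads `2 = sin(3π/2)`. -/
theorem six_mul_eq (h : IsSimpleCurrentExtension n m) {a : ℕ} (hna : n = 6 * a)
    (hcol : ∀ c, 1 ≤ c → c < n → m c a = if 2 * c = n then 1 else 0) : n = 18 := by
  have hn := h.six_le
  have hn4 := h.mod_four
  have h3a : a % 3 = 0 := by
    have h1 := h.table.sq_modEq (3 * a) a (by omega) (by omega) (by omega) (by omega)
      (by rw [hcol _ (by omega) (by omega), if_pos (by omega)]; norm_num)
    rw [hna] at h1
    have h2 := (Nat.modEq_iff_dvd' (by nlinarith)).1 h1.symm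
    rw [show (3 * a) ^ 2 - a ^ 2 = a * (8 * a) by
      rw [Nat.sub_eq_iff_eq_add (by nlinarith)]; ring, show 4 * (6 * a) = a * 24 by ring] at h2
    have := Nat.dvd_of_mul_dvd_mul_left (by omega) h2
    omega
  by_contra hne
  have h1 := h.table.comm 3 a (by omega) (by omega) (by omega) (by omega)
  rw [sum_label_eq (f := fun c => sinPi n (3 * c) * (m c a : ℝ)) (i := 3 * a) (by omega)
    (by omega) (fun c hc hc' hcf => by
      rw [hcol c hc hc', if_neg (by omega)]; simp), hcol _ (by omega) (by omega),
    if_pos (by omega)] at h1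
  have h3 : sinPi n (3 * a) = 1 := sinPi_half (by omega) (by omega)
  have h9 : sinPi n (3 * (3 * a)) = -1 := by
    have h2 := sinPi_two_mul_sub (n := n) (k := 3 * a) (by omega) (by omega)
    rw [h3] at h2
    rw [← h2]
    congr 1
    omega
  rw [h9] at h1
  rcases h.transpose.col_dichotomy (b := 3) (by omega) (by omega) (by norm_num) (by omega) with
    ⟨h33, h33', h0⟩ | ⟨h6, _⟩
  · rw [sum_label_eq_add (i := 3) (j := n - 3) (by omega) (by omega) (by omega) (by omega)
      (by omega) (fun k hk hk' hk1 hk2 => by simp [h0 k hk hk' hk1 hk2]), h33, h33',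
      sinPi_sub_mul (by omega) (by omega), h3, Even.neg_one_pow (by rw [Nat.even_iff]; omega)] at h1
    norm_num at h1
  · omega

theorem col_type_one (h : IsSimpleCurrentExtension n m)
    (hex : ¬ ∃ b, n = 6 * b ∧ ∀ c, 1 ≤ c → c < n → m c b = if 2 * c = n then 1 else 0)
    {b : ℕ} (hb : 1 ≤ b) (hb' : b < n) (hb2 : b % 2 = 1) (hbf : 2 * b ≠ n) :
    m b b = 1 ∧ m (n - b) b = 1 ∧ ∀ c, 1 ≤ c → c < n → c ≠ b → c ≠ n - b → m c b = 0 := by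
  rcases h.col_dichotomy hb hb' hb2 hbf with h1 | ⟨h1 | h1, h2⟩
  · exact h1
  · exact absurd ⟨b, h1, h2⟩ hex
  · refine absurd ⟨n - b, h1, fun c hc hc' => ?_⟩ hex
    rw [h.entry_sub hc hc' hb hb', h2 c hc hc']

/-- The simple current extensions: the `D` series for `n / 2` odd, and `E₇`. -/
theorem classification (h : IsSimpleCurrentExtension n m) :
    (∀ a b, 1 ≤ a → a < n → 1 ≤ b → b < n → m a b =
      if a % 2 = 1 ∧ b % 2 = 1 then (if a = b then 1 else 0) + (if a = n - b then 1 else 0)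
      else 0) ∨
    (n = 18 ∧ ∀ a b, 1 ≤ a → a < 18 → 1 ≤ b → b < 18 → m a b = tableE7 a b) := by
  have hn := h.six_le
  have hn4 := h.mod_four
  obtain ⟨f, hf⟩ : ∃ f, n = 2 * f := ⟨n / 2, by omega⟩
  have hff := h.col_sum_odd (b := f) (by omega) (by omega) (by omega)
  rw [sinPi_half hf (by omega)] at hff
  have heven : ∀ a b, 1 ≤ a → a < n → 1 ≤ b → b < n → ¬(a % 2 = 1 ∧ b % 2 = 1) → m a b = 0 := by
    intro a b ha ha' hb hb' hab
    rcases Nat.mod_two_eq_zero_or_one b with h0 | h0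
    · exact h.entry_even ha ha' hb hb' h0
    · exact h.transpose.entry_even hb hb' ha ha' (by omega)
  by_cases hex : ∃ b, n = 6 * b ∧ ∀ c, 1 ≤ c → c < n → m c b = if 2 * c = n then 1 else 0
  · right
    obtain ⟨b0, hb0, hcol⟩ := hex
    have h18 := h.six_mul_eq hb0 hcol
    subst h18
    refine ⟨rfl, ?_⟩
    obtain rfl : b0 = 3 := by omega
    obtain rfl : f = 9 := by omega
    have hcol' : ∀ c, 1 ≤ c → c < 18 → m c 15 = if 2 * c = 18 then 1 else 0 := by
      intro c hc hc'
      rw [← hcol c hc hc', ← h.entry_sub hc hc' (by norm_num : 1 ≤ 3) (by norm_num)]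
    have hrow3 : m 3 9 = 1 := by
      rcases h.transpose.col_dichotomy (b := 3) (by norm_num) (by norm_num) (by norm_num)
        (by norm_num) with ⟨h1, _⟩ | ⟨_, h1⟩
      · simp [hcol 3] at h1
      · simpa using h1 9
    have hrow15 : m 15 9 = 1 := by
      rw [← hrow3]
      exact h.transpose.entry_sub (a := 9) (b := 3) (by norm_num) (by norm_num) (by norm_num)
        (by norm_num)
    have htype : ∀ a, a % 6 ≠ 3 → 1 ≤ a → a < 18 → a % 2 = 1 → m a 9 = 0 := by
      intro a h6 ha ha' ha2
      rcases h.transpose.col_dichotomy (b := a) ha ha' ha2 (by omega) with ⟨_, _, h1⟩ | ⟨h1, _⟩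
      · exact h1 9 (by norm_num) (by norm_num) (by omega) (by omega)
      · omega
    -- The weighted sum of column `9` is `2`. Labels `3` and `15` contribute `sin(π/6) = 1/2` each,
    -- a value read off from column `3`, and `9` has weight `1`.
    have h99 : m 9 9 = 1 := by
      have h1 := h.col_sum_odd (b := 3) (by norm_num) (by norm_num) (by norm_num)
      rw [sum_label_eq (i := 9) (by norm_num) (by norm_num) (fun c hc hc' hc9 => by
        rw [hcol c hc hc', if_neg (by omega)]; simp), hcol 9 (by norm_num) (by norm_num),
        sinPi_half hf (by norm_num)] at h1
      have h15 : sinPi 18 15 = sinPi 18 3 := sinPi_sub (n := 18) (a := 3) (by norm_num) (by norm_num)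
      have h3 : ∑ c ∈ Ico 1 18, sinPi 18 c * (m c 9 : ℝ)
          = sinPi 18 3 * (m 3 9 : ℝ) + (sinPi 18 9 * m 9 9 + sinPi 18 15 * m 15 9) := by
        rw [← sum_pair (f := fun c => sinPi 18 c * (m c 9 : ℝ)) (by norm_num : 9 ≠ 15),
          ← sum_insert (f := fun c => sinPi 18 c * (m c 9 : ℝ)) (by simp : 3 ∉ ({9, 15} : Finset ℕ))]
        symm
        apply sum_subset
        · decide
        · intro c hc hc'
          simp only [mem_insert, mem_singleton, not_or] at hc'
          have hc := mem_Ico.1 hc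
          by_cases hc2 : c % 2 = 1
          · rw [htype c (by omega) hc.1 hc.2 hc2]; simp
          · rw [heven c 9 hc.1 hc.2 (by norm_num) (by norm_num) (by omega)]; simp
      rw [h3, hrow3, hrow15, h15, sinPi_half hf (by norm_num)] at hff
      norm_num at h1 hff
      have h4 : (m 9 9 : ℝ) = 1 := by linarith
      exact_mod_cast h4
    have hval : ∀ a b, 1 ≤ a → a < 18 → 1 ≤ b → b < 18 → m a b =
        if a % 2 = 1 ∧ b % 2 = 1 then
          if b % 6 = 3 then (if b = 9 then (if a % 6 = 3 then 1 else 0) else if a = 9 then 1 else 0)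
          else (if a = b ∨ a = 18 - b then 1 else 0)
        else 0 := by
      intro a b ha ha' hb hb'
      split_ifs with h2 h6 h9 ha6 ha9 hab
      · subst h9
        have : a = 3 ∨ a = 9 ∨ a = 15 := by omega
        rcases this with rfl | rfl | rfl <;> assumption
      · subst h9
        exact htype a ha6 ha ha' h2.1
      · subst ha9
        have : b = 3 ∨ b = 15 := by omega
        rcases this with rfl | rfl
        · simp [hcol]
        · simp [hcol']
      · have : b = 3 ∨ b = 15 := by omega
        rcases this with rfl | rfl
        · rw [hcol a ha ha', if_neg (by omega)]
        · rw [hcol' a ha ha', if_neg (by omega)]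
      · rcases h.col_dichotomy hb hb' h2.2 (by omega) with ⟨h1, h3, _⟩ | ⟨h1, _⟩
        · rcases hab with rfl | rfl <;> assumption
        · omega
      · rcases h.col_dichotomy hb hb' h2.2 (by omega) with ⟨_, _, h1⟩ | ⟨h1, _⟩
        · exact h1 a ha ha' (by omega) (by omega)
        · omega
      · exact heven a b ha ha' hb hb' h2
    intro a b ha ha' hb hb'
    rw [hval a b ha ha' hb hb']
    have key : ∀ a < 18, ∀ b < 18, 1 ≤ a → 1 ≤ b →
        (if a % 2 = 1 ∧ b % 2 = 1 then
          if b % 6 = 3 then (if b = 9 then (if a % 6 = 3 then 1 else 0) else if a = 9 then 1 else 0)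
          else (if a = b ∨ a = 18 - b then 1 else 0)
        else 0) = tableE7 a b := by decide +kernel
    exact key a ha' b hb' ha hb
  · left
    intro a b ha ha' hb hb'
    have htype := fun (b : ℕ) (hb : 1 ≤ b) (hb' : b < n) => h.col_type_one hex hb hb'
    -- A row `a` concentrated on `f` would contradict the entry `1` at `(a, a)` already known from
    -- column `a`. The middle column is then supported on `f` alone, where its sum `2` gives the
    -- coefficient `2`.
    have hrow : ∀ a, 1 ≤ a → a < n → a % 2 = 1 → a ≠ f → m a f = 0 := by
      intro a ha ha' ha2 haf
      rcases h.transpose.col_dichotomy ha ha' ha2 (by omega) with ⟨_, _, h1⟩ | ⟨_, h1⟩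
      · exact h1 f (by omega) (by omega) (by omega) (by omega)
      · have h2 := h1 a ha ha'
        rw [if_neg (by omega)] at h2
        have h3 := (htype a ha ha' ha2 (by omega)).1
        omega
    split_ifs with h2 hab hab' hab'
    · have hbf : b = f := by omega
      subst hab hbf
      rw [sum_label_eq ha ha' (fun c hc hc' hcf => by
        by_cases hc2 : c % 2 = 1
        · rw [hrow c hc hc' hc2 hcf]; simp
        · rw [heven c a hc hc' ha ha' (by omega)]; simp), sinPi_half hf (by omega)] at hff
      have : (m a a : ℝ) = 2 := by linarith
      exact_mod_cast this
    · subst hab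
      exact (htype a ha ha' h2.1 (by omega)).1
    · subst hab'
      exact (htype b hb hb' h2.2 (by omega)).2.1
    · by_cases hbf : b = f
      · subst hbf
        exact hrow a ha ha' h2.1 hab
      · exact (htype b hb hb' h2.2 (by omega)).2.2 a ha ha' hab hab'
    · exact heven a b ha ha' hb hb' h2

end IsSimpleCurrentExtension

/-! ### The exceptional first row for `n = 12`: `E₆` -/

/-- Reduction of the argument of `sinPi` to the first quadrant. -/
theorem sinPi_reduce {n : ℕ} (hn : 0 < n) (k : ℕ) : sinPi n k =
    if k % (2 * n) ≤ n then
      if 2 * (k % (2 * n)) ≤ n then sinPi n (k % (2 * n)) else sinPi n (n - k % (2 * n))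
    else if 2 * (2 * n - k % (2 * n)) ≤ n then -sinPi n (2 * n - k % (2 * n))
      else -sinPi n (k % (2 * n) - n) := by
  rw [sinPi_mod hn k]
  have hr : k % (2 * n) < 2 * n := Nat.mod_lt _ (by omega)
  generalize k % (2 * n) = r at *
  split_ifs with h1 h2 h2
  · rfl
  · rw [sinPi_sub hn h1]
  · rw [sinPi_two_mul_sub hn hr.le, neg_neg]
  · rw [show r - n = n - (2 * n - r) by omega, sinPi_sub hn (by omega),
      sinPi_two_mul_sub hn hr.le, neg_neg]

theorem sinPi_zero (n : ℕ) : sinPi n 0 = 0 := by simp [sinPi]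

theorem sinPi_lt_sinPi {n a b : ℕ} (hab : a < b) (hb : 2 * b ≤ n) : sinPi n a < sinPi n b := by
  have hn : (0 : ℝ) < n := by exact_mod_cast (by omega : 0 < n)
  have hab' : (a : ℝ) < b := by exact_mod_cast hab
  have hb' : 2 * (b : ℝ) ≤ n := by exact_mod_cast hb
  have ha' : (0 : ℝ) ≤ a := Nat.cast_nonneg a
  have hpi := Real.pi_pos
  apply Real.sin_lt_sin_of_lt_of_le_pi_div_two
  · have : 0 ≤ Real.pi * a / n := by positivity
    linarith
  · rw [div_le_div_iff₀ hn two_pos]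
    nlinarith
  · gcongr

theorem sum_label_of_subset {n : ℕ} (t : Finset ℕ) (ht : t ⊆ Ico 1 n) {f : ℕ → ℝ}
    (hf : ∀ k, 1 ≤ k → k < n → k ∉ t → f k = 0) : ∑ k ∈ Ico 1 n, f k = ∑ k ∈ t, f k :=
  (sum_subset ht fun k hk hkt => hf k (mem_Ico.1 hk).1 (mem_Ico.1 hk).2 hkt).symm

/-- An invariant table for `n = 12` whose first row and column are those of `E₆`. -/
structure IsE6Extension (m : ℕ → ℕ → ℕ) : Prop where
  table : IsInvariantTable 12 m
  row : m 1 7 = 1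
  row_zero : ∀ b, 1 ≤ b → b < 12 → b ∉ ({1, 7} : Finset ℕ) → m 1 b = 0
  col : m 7 1 = 1
  col_zero : ∀ a, 1 ≤ a → a < 12 → a ∉ ({1, 7} : Finset ℕ) → m a 1 = 0

namespace IsE6Extension

variable {m : ℕ → ℕ → ℕ}

theorem transpose (h : IsE6Extension m) : IsE6Extension fun a b => m b a :=
  ⟨h.table.transpose, h.col, h.col_zero, h.row, h.row_zero⟩

theorem col_sum (h : IsE6Extension m) {b : ℕ} (hb : 1 ≤ b) (hb' : b < 12) :
    ∑ c ∈ Ico 1 12, sinPi 12 c * (m c b : ℝ) = sinPi 12 b + sinPi 12 (7 * b) := by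
  have h1 := h.table.comm 1 b le_rfl (by norm_num) hb hb'
  rw [sum_label_of_subset {1, 7} (by decide)
    (fun k hk hk' hkt => by simp [h.row_zero k hk hk' hkt]), sum_pair (by norm_num),
    h.table.one_one, h.row] at h1
  simp only [Nat.cast_one, one_mul] at h1
  exact h1.symm

theorem entry_eq_zero (h : IsE6Extension m) {a b : ℕ} (ha : 1 ≤ a) (ha' : a < 12) (hb : 1 ≤ b)
    (hb' : b < 12) (hb2 : b ∈ ({2, 3, 6, 9, 10} : Finset ℕ)) : m a b = 0 := by
  apply IsInvariantTable.col_eq_zero ha ha'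
  rw [h.col_sum hb hb', sinPi_reduce (by norm_num) b, sinPi_reduce (by norm_num) (7 * b)]
  simp only [mem_insert, mem_singleton] at hb2
  rcases hb2 with rfl | rfl | rfl | rfl | rfl <;> norm_num

/-- Vanishing rows and columns leave the labels `1, 4, 5, 7, 8, 11`, whose squares modulo `48` are
`1, 16, 25, 1, 16, 25`. These classes are exactly the blocks. -/
theorem entry_eq_zero_of_table (h : IsE6Extension m) {a b : ℕ} (ha : 1 ≤ a) (ha' : a < 12)
    (hb : 1 ≤ b) (hb' : b < 12) (hab : tableE6 a b = 0) : m a b = 0 := by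
  by_cases hb2 : b ∈ ({2, 3, 6, 9, 10} : Finset ℕ)
  · exact h.entry_eq_zero ha ha' hb hb' hb2
  by_cases ha2 : a ∈ ({2, 3, 6, 9, 10} : Finset ℕ)
  · exact h.transpose.entry_eq_zero hb hb' ha ha' ha2
  by_contra hne
  have h1 := h.table.sq_modEq a b ha ha' hb hb' hne
  have key : ∀ a ∈ range 12, ∀ b ∈ range 12, 1 ≤ a → 1 ≤ b → b ∉ ({2, 3, 6, 9, 10} : Finset ℕ) →
      a ∉ ({2, 3, 6, 9, 10} : Finset ℕ) → a ^ 2 % 48 = b ^ 2 % 48 → tableE6 a b ≠ 0 := by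
    decide +kernel
  exact key a (mem_range.2 ha') b (mem_range.2 hb') ha hb hb2 ha2 h1 hab

/-- When column `b` vanishes, the side `S M` of commutation is zero, which leaves a linear relation
inside row `a`. -/
theorem row_relation (h : IsE6Extension m) {a b : ℕ} (ha : 1 ≤ a) (ha' : a < 12) (hb : 1 ≤ b)
    (hb' : b < 12) (hb2 : b ∈ ({2, 3, 6, 9, 10} : Finset ℕ)) (t : Finset ℕ) (ht : t ⊆ Ico 1 12)
    (hat : ∀ c < 12, c ∉ t → tableE6 a c = 0) : ∑ c ∈ t, (m a c : ℝ) * sinPi 12 (c * b) = 0 := by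
  rw [← sum_label_of_subset t ht fun k hk hk' hkt => by
    simp [h.entry_eq_zero_of_table ha ha' hk hk' (hat k hk' hkt)], h.table.comm a b ha ha' hb hb']
  refine sum_eq_zero fun c hc => ?_
  rw [h.entry_eq_zero (mem_Ico.1 hc).1 (mem_Ico.1 hc).2 hb hb' hb2]
  simp

theorem col_relation (h : IsE6Extension m) {b : ℕ} (hb : 1 ≤ b) (hb' : b < 12) (t : Finset ℕ)
    (ht : t ⊆ Ico 1 12) (hbt : ∀ c < 12, c ∉ t → tableE6 c b = 0) :
    ∑ c ∈ t, sinPi 12 c * (m c b : ℝ) = sinPi 12 b + sinPi 12 (7 * b) := by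
  rw [← h.col_sum hb hb', sum_label_of_subset t ht fun k hk hk' hkt => by
    simp [h.entry_eq_zero_of_table hk hk' hb hb' (hbt k hk' hkt)]]

theorem row_entries (h : IsE6Extension m) :
    m 7 7 = m 7 1 ∧ m 5 11 = m 5 5 ∧ m 11 11 = m 11 5 ∧ m 4 8 = m 4 4 ∧ m 8 8 = m 8 4 := by
  have s3 := sinPi_pos (n := 12) (k := 3) (by norm_num) (by norm_num)
  have s4 := sinPi_pos (n := 12) (k := 4) (by norm_num) (by norm_num)
  have e15 : sinPi 12 15 = -sinPi 12 3 := by rw [sinPi_reduce (by norm_num)]; norm_num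
  have e21 : sinPi 12 21 = -sinPi 12 3 := by rw [sinPi_reduce (by norm_num)]; norm_num
  have e33 : sinPi 12 33 = sinPi 12 3 := by rw [sinPi_reduce (by norm_num)]; norm_num
  have e8 : sinPi 12 8 = sinPi 12 4 := by rw [sinPi_reduce (by norm_num)]; norm_num
  have e16 : sinPi 12 16 = -sinPi 12 4 := by rw [sinPi_reduce (by norm_num)]; norm_num
  have cancel : ∀ {x y : ℕ} {s : ℝ}, 0 < s → (x : ℝ) * s + y * -s = 0 → y = x := by
    intro x y s hs hxy
    have h1 : ((x : ℝ) - y) * s = 0 := by linear_combination hxy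
    have h2 := (mul_eq_zero.1 h1).resolve_right hs.ne'
    exact_mod_cast (sub_eq_zero.1 h2).symm
  have r7 := h.row_relation (a := 7) (b := 3) (by norm_num) (by norm_num) (by norm_num)
    (by norm_num) (by decide) {1, 7} (by decide) (by decide)
  -- At `b = 3` label `11` carries the positive sine and `5` the negative one; the set is written in
  -- that order to match `cancel`.
  have r5 := h.row_relation (a := 5) (b := 3) (by norm_num) (by norm_num) (by norm_num)
    (by norm_num) (by decide) {11, 5} (by decide) (by decide)
  have r11 := h.row_relation (a := 11) (b := 3) (by norm_num) (by norm_num) (by norm_num)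
    (by norm_num) (by decide) {11, 5} (by decide) (by decide)
  have r4 := h.row_relation (a := 4) (b := 2) (by norm_num) (by norm_num) (by norm_num)
    (by norm_num) (by decide) {4, 8} (by decide) (by decide)
  have r8 := h.row_relation (a := 8) (b := 2) (by norm_num) (by norm_num) (by norm_num)
    (by norm_num) (by decide) {4, 8} (by decide) (by decide)
  rw [sum_pair (by norm_num)] at r7 r5 r11 r4 r8
  norm_num only [e15, e21, e33, e8, e16] at r7 r5 r11 r4 r8
  exact ⟨cancel s3 r7, (cancel s3 r5).symm, (cancel s3 r11).symm, cancel s4 r4, cancel s4 r8⟩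

/-- The row relations and their transposes make each block constant; the weighted sums of columns
`5` and `4` normalise the last two constants to `1`. -/
theorem eq_tableE6 (h : IsE6Extension m) :
    ∀ a b, 1 ≤ a → a < 12 → 1 ≤ b → b < 12 → m a b = tableE6 a b := by
  have s1 := sinPi_pos (n := 12) (k := 1) (by norm_num) (by norm_num)
  have s4 := sinPi_pos (n := 12) (k := 4) (by norm_num) (by norm_num)
  have s5 := sinPi_pos (n := 12) (k := 5) (by norm_num) (by norm_num)
  obtain ⟨h77, h5, h11, h4, h8⟩ := h.row_entries
  obtain ⟨-, h5', h11', h4', h8'⟩ := h.transpose.row_entries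
  have e35 : sinPi 12 35 = sinPi 12 1 := by rw [sinPi_reduce (by norm_num)]; norm_num
  have e11 : sinPi 12 11 = sinPi 12 1 := by rw [sinPi_reduce (by norm_num)]; norm_num
  have e8 : sinPi 12 8 = sinPi 12 4 := by rw [sinPi_reduce (by norm_num)]; norm_num
  have e28 : sinPi 12 28 = sinPi 12 4 := by rw [sinPi_reduce (by norm_num)]; norm_num
  have c5 := h.col_relation (b := 5) (by norm_num) (by norm_num) {5, 11} (by decide) (by decide)
  have c4 := h.col_relation (b := 4) (by norm_num) (by norm_num) {4, 8} (by decide) (by decide)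
  rw [sum_pair (by norm_num)] at c5 c4
  rw [h5', e11] at c5
  rw [h4', e8] at c4
  norm_num only [e35, e28] at c5 c4
  have h55 : m 5 5 = 1 := by
    have h1 : (sinPi 12 5 + sinPi 12 1) * ((m 5 5 : ℝ) - 1) = 0 := by linear_combination c5
    have h2 := (mul_eq_zero.1 h1).resolve_left (by positivity)
    exact_mod_cast sub_eq_zero.1 h2
  have h44 : m 4 4 = 1 := by
    have h1 : (sinPi 12 4 + sinPi 12 4) * ((m 4 4 : ℝ) - 1) = 0 := by linear_combination c4
    have h2 := (mul_eq_zero.1 h1).resolve_left (by positivity)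
    exact_mod_cast sub_eq_zero.1 h2
  intro a b ha ha' hb hb'
  by_cases h0 : tableE6 a b = 0
  · rw [h0, h.entry_eq_zero_of_table ha ha' hb hb' h0]
  have key : ∀ a ∈ range 12, ∀ b ∈ range 12, tableE6 a b ≠ 0 → tableE6 a b = 1 ∧
      (((a = 1 ∨ a = 7) ∧ (b = 1 ∨ b = 7)) ∨ ((a = 4 ∨ a = 8) ∧ (b = 4 ∨ b = 8)) ∨
        ((a = 5 ∨ a = 11) ∧ (b = 5 ∨ b = 11))) := by decide +kernel
  obtain ⟨h1, hab⟩ := key a (mem_range.2 ha') b (mem_range.2 hb') h0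
  rw [h1]
  have := h.table.one_one
  have := h.row
  have := h.col
  rcases hab with ⟨rfl | rfl, rfl | rfl⟩ | ⟨rfl | rfl, rfl | rfl⟩ | ⟨rfl | rfl, rfl | rfl⟩ <;> omega

end IsE6Extension

/-! ### The exceptional first row for `n = 30`: `E₈` -/

/-- An invariant table for `n = 30` whose first row and column are those of `E₈`. -/
structure IsE8Extension (m : ℕ → ℕ → ℕ) : Prop where
  table : IsInvariantTable 30 m
  row : ∀ b ∈ ({1, 11, 19, 29} : Finset ℕ), m 1 b = 1
  row_zero : ∀ b, 1 ≤ b → b < 30 → b ∉ ({1, 11, 19, 29} : Finset ℕ) → m 1 b = 0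
  col : ∀ a ∈ ({1, 11, 19, 29} : Finset ℕ), m a 1 = 1
  col_zero : ∀ a, 1 ≤ a → a < 30 → a ∉ ({1, 11, 19, 29} : Finset ℕ) → m a 1 = 0

theorem sum_four {f : ℕ → ℝ} {i j k l : ℕ} (hij : i ≠ j) (hik : i ≠ k) (hil : i ≠ l) (hjk : j ≠ k)
    (hjl : j ≠ l) (hkl : k ≠ l) : ∑ c ∈ {i, j, k, l}, f c = f i + f j + f k + f l := by
  rw [sum_insert (by simp [*]), sum_insert (by simp [*]), sum_pair hkl]
  ring

namespace IsE8Extension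

variable {m : ℕ → ℕ → ℕ}

theorem transpose (h : IsE8Extension m) : IsE8Extension fun a b => m b a :=
  ⟨h.table.transpose, h.col, h.col_zero, h.row, h.row_zero⟩

theorem col_sum (h : IsE8Extension m) {b : ℕ} (hb : 1 ≤ b) (hb' : b < 30) :
    ∑ c ∈ Ico 1 30, sinPi 30 c * (m c b : ℝ)
      = sinPi 30 b + sinPi 30 (11 * b) + sinPi 30 (19 * b) + sinPi 30 (29 * b) := by
  have h1 := h.table.comm 1 b le_rfl (by norm_num) hb hb'
  rw [sum_label_of_subset {1, 11, 19, 29} (by decide)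
    (fun k hk hk' hkt => by simp [h.row_zero k hk hk' hkt]),
    sum_four (by norm_num) (by norm_num) (by norm_num) (by norm_num) (by norm_num) (by norm_num),
    h.row 1 (by decide), h.row 11 (by decide), h.row 19 (by decide), h.row 29 (by decide)] at h1
  simp only [Nat.cast_one, one_mul] at h1
  exact h1.symm

theorem entry_eq_zero (h : IsE8Extension m) {a b : ℕ} (ha : 1 ≤ a) (ha' : a < 30) (hb : 1 ≤ b)
    (hb' : b < 30) (hb2 : ¬ Nat.Coprime b 30) : m a b = 0 := by
  apply IsInvariantTable.col_eq_zero ha ha'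
  rw [h.col_sum hb hb', sinPi_reduce (by norm_num) b, sinPi_reduce (by norm_num) (11 * b),
    sinPi_reduce (by norm_num) (19 * b), sinPi_reduce (by norm_num) (29 * b)]
  interval_cases b <;> first | (norm_num at hb2; done) | norm_num

/-- The surviving labels are coprime to `30`, so their squares are `1` modulo `24`. Modulo `5` the
squares are `1` on one block and `-1` on the other. -/
theorem entry_eq_zero_of_table (h : IsE8Extension m) {a b : ℕ} (ha : 1 ≤ a) (ha' : a < 30)
    (hb : 1 ≤ b) (hb' : b < 30) (hab : tableE8 a b = 0) : m a b = 0 := by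
  by_cases hb2 : Nat.Coprime b 30
  swap; · exact h.entry_eq_zero ha ha' hb hb' hb2
  by_cases ha2 : Nat.Coprime a 30
  swap; · exact h.transpose.entry_eq_zero hb hb' ha ha' ha2
  by_contra hne
  have h1 := h.table.sq_modEq a b ha ha' hb hb' hne
  have key : ∀ a ∈ range 30, ∀ b ∈ range 30, Nat.Coprime b 30 → Nat.Coprime a 30 →
      a ^ 2 % 120 = b ^ 2 % 120 → tableE8 a b ≠ 0 := by
    decide +kernel
  exact key a (mem_range.2 ha') b (mem_range.2 hb') hb2 ha2 h1 hab

theorem entry_sub (h : IsE8Extension m) {a b : ℕ} (ha : 1 ≤ a) (ha' : a < 30) (hb : 1 ≤ b)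
    (hb' : b < 30) : m a (30 - b) = m a b := by
  refine h.table.col_sub (fun a b ha ha' hb hb' hb2 => h.entry_eq_zero ha ha' hb hb' ?_) ha ha' hb hb'
  rw [show 30 = 2 * 15 by norm_num, Nat.coprime_mul_iff_right, Nat.coprime_two_right, Nat.odd_iff]
  omega

theorem row_relation (h : IsE8Extension m) {a : ℕ} (ha : 1 ≤ a) (ha' : a < 30) (t : Finset ℕ)
    (ht : t ⊆ Ico 1 30) (hat : ∀ c < 30, c ∉ t → tableE8 a c = 0) :
    ∑ c ∈ t, (m a c : ℝ) * sinPi 30 (c * 3) = 0 := by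
  rw [← sum_label_of_subset t ht fun k hk hk' hkt => by
    simp [h.entry_eq_zero_of_table ha ha' hk hk' (hat k hk' hkt)],
    h.table.comm a 3 ha ha' (by norm_num) (by norm_num)]
  refine sum_eq_zero fun c hc => ?_
  rw [h.entry_eq_zero (mem_Ico.1 hc).1 (mem_Ico.1 hc).2 (by norm_num) (by norm_num) (by norm_num)]
  simp

/-- Column `3` vanishes. On each block, sines at multiples of `3` have one absolute value with signs
`+, -, -, +`; with the symmetry `b ↦ 30 - b`, the relation equates the two independent entries. -/
theorem row_entries (h : IsE8Extension m) :
    m 11 11 = m 11 1 ∧ m 7 13 = m 7 7 ∧ m 13 13 = m 13 7 := by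
  have s3 := sinPi_pos (n := 30) (k := 3) (by norm_num) (by norm_num)
  have s9 := sinPi_pos (n := 30) (k := 9) (by norm_num) (by norm_num)
  have e33 : sinPi 30 33 = -sinPi 30 3 := by rw [sinPi_reduce (by norm_num)]; norm_num
  have e57 : sinPi 30 57 = -sinPi 30 3 := by rw [sinPi_reduce (by norm_num)]; norm_num
  have e87 : sinPi 30 87 = sinPi 30 3 := by rw [sinPi_reduce (by norm_num)]; norm_num
  have e21 : sinPi 30 21 = sinPi 30 9 := by rw [sinPi_reduce (by norm_num)]; norm_num
  have e39 : sinPi 30 39 = -sinPi 30 9 := by rw [sinPi_reduce (by norm_num)]; norm_num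
  have e51 : sinPi 30 51 = -sinPi 30 9 := by rw [sinPi_reduce (by norm_num)]; norm_num
  have e69 : sinPi 30 69 = sinPi 30 9 := by rw [sinPi_reduce (by norm_num)]; norm_num
  have cancel : ∀ {x y : ℕ} {s : ℝ}, 0 < s → (x : ℝ) * s + y * -s + y * -s + x * s = 0 → y = x := by
    intro x y s hs hxy
    have h1 : ((x : ℝ) - y) * s = 0 := by linear_combination hxy / 2
    have h2 := (mul_eq_zero.1 h1).resolve_right hs.ne'
    exact_mod_cast (sub_eq_zero.1 h2).symm
  have hJ : ∀ a b c, 1 ≤ a ∧ a < 30 ∧ 1 ≤ b ∧ b < 30 ∧ c = 30 - b → m a c = m a b := by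
    rintro a b c ⟨ha, ha', hb, hb', rfl⟩
    exact h.entry_sub ha ha' hb hb'
  have r11 := h.row_relation (a := 11) (by norm_num) (by norm_num) {1, 11, 19, 29} (by decide)
    (by decide)
  have r7 := h.row_relation (a := 7) (by norm_num) (by norm_num) {7, 13, 17, 23} (by decide)
    (by decide)
  have r13 := h.row_relation (a := 13) (by norm_num) (by norm_num) {7, 13, 17, 23} (by decide)
    (by decide)
  rw [sum_four (by norm_num) (by norm_num) (by norm_num) (by norm_num) (by norm_num) (by norm_num)]
    at r11 r7 r13
  rw [hJ _ 11 19 (by norm_num), hJ _ 1 29 (by norm_num)] at r11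
  rw [hJ _ 13 17 (by norm_num), hJ _ 7 23 (by norm_num)] at r7 r13
  norm_num only [e33, e57, e87, e21, e39, e51, e69] at r11 r7 r13
  exact ⟨cancel s3 r11, cancel s9 r7, cancel s9 r13⟩

theorem eq_tableE8 (h : IsE8Extension m) :
    ∀ a b, 1 ≤ a → a < 30 → 1 ≤ b → b < 30 → m a b = tableE8 a b := by
  have s7 := sinPi_pos (n := 30) (k := 7) (by norm_num) (by norm_num)
  have s13 := sinPi_pos (n := 30) (k := 13) (by norm_num) (by norm_num)
  obtain ⟨h11, h7, h13⟩ := h.row_entries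
  obtain ⟨-, h7', h13'⟩ := h.transpose.row_entries
  have hJ : ∀ a b, 1 ≤ a → a < 30 → 1 ≤ b → b < 30 → m a (30 - b) = m a b :=
    fun a b ha ha' hb hb' => h.entry_sub ha ha' hb hb'
  have hJ' : ∀ a b, 1 ≤ a → a < 30 → 1 ≤ b → b < 30 → m (30 - a) b = m a b :=
    fun a b ha ha' hb hb' => h.transpose.entry_sub hb hb' ha ha'
  have e77 : sinPi 30 77 = sinPi 30 13 := by rw [sinPi_reduce (by norm_num)]; norm_num
  have e133 : sinPi 30 133 = sinPi 30 13 := by rw [sinPi_reduce (by norm_num)]; norm_num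
  have e203 : sinPi 30 203 = sinPi 30 7 := by rw [sinPi_reduce (by norm_num)]; norm_num
  have e17 : sinPi 30 17 = sinPi 30 13 := by rw [sinPi_reduce (by norm_num)]; norm_num
  have e23 : sinPi 30 23 = sinPi 30 7 := by rw [sinPi_reduce (by norm_num)]; norm_num
  have hv : ∀ c < 30, c ∉ ({7, 13, 17, 23} : Finset ℕ) → tableE8 c 7 = 0 := by decide
  have c7 := h.col_sum (b := 7) (by norm_num) (by norm_num)
  rw [sum_label_of_subset {7, 13, 17, 23} (by decide) fun k hk hk' hkt => by
    simp [h.entry_eq_zero_of_table hk hk' (by norm_num : 1 ≤ 7) (by norm_num) (hv k hk' hkt)],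
    sum_four (by norm_num) (by norm_num) (by norm_num) (by norm_num) (by norm_num) (by norm_num),
    show m 17 7 = m 13 7 from hJ' 13 7 (by norm_num) (by norm_num) (by norm_num) (by norm_num),
    show m 23 7 = m 7 7 from hJ' 7 7 (by norm_num) (by norm_num) (by norm_num) (by norm_num),
    h7', e17, e23] at c7
  norm_num only [e77, e133, e203] at c7
  have h77 : m 7 7 = 1 := by
    have h1 : (sinPi 30 7 + sinPi 30 13) * ((m 7 7 : ℝ) - 1) = 0 := by linear_combination c7 / 2
    have h2 := (mul_eq_zero.1 h1).resolve_left (by positivity)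
    exact_mod_cast sub_eq_zero.1 h2
  have h1 := h.table.one_one
  have h1' := h.row 11 (by decide)
  have h1'' := h.col 11 (by decide)
  intro a b ha ha' hb hb'
  by_cases h0 : tableE8 a b = 0
  · rw [h0, h.entry_eq_zero_of_table ha ha' hb hb' h0]
  have key : ∀ a ∈ range 30, ∀ b ∈ range 30, tableE8 a b ≠ 0 → tableE8 a b = 1 ∧
      ∃ a' ∈ range 15, ∃ b' ∈ range 15, (a = a' ∨ a = 30 - a') ∧ (b = b' ∨ b = 30 - b') ∧
      (((a' = 1 ∨ a' = 11) ∧ (b' = 1 ∨ b' = 11)) ∨ ((a' = 7 ∨ a' = 13) ∧ (b' = 7 ∨ b' = 13))) := by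
    decide +kernel
  obtain ⟨hone, a', ha15, b', hb15, haa, hbb, hab⟩ := key a (mem_range.2 ha') b (mem_range.2 hb') h0
  rw [hone]
  rw [mem_range] at ha15 hb15
  have hm : m a b = m a' b' := by
    rcases haa with rfl | rfl <;> rcases hbb with rfl | rfl
    · rfl
    · exact hJ _ _ ha ha' (by omega) (by omega)
    · exact hJ' _ _ (by omega) (by omega) hb hb'
    · rw [hJ _ _ ha ha' (by omega) (by omega), hJ' _ _ (by omega) (by omega) (by omega) (by omega)]
  rw [hm]
  clear hm key hJ hJ' hv
  rcases hab with ⟨rfl | rfl, rfl | rfl⟩ | ⟨rfl | rfl, rfl | rfl⟩ <;> omega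

end IsE8Extension

/-! ### Multiplicities in the first row and assembly of the cases -/

namespace IsInvariantTable

variable {n : ℕ} {m : ℕ → ℕ → ℕ}

theorem classification_of_support (h : IsInvariantTable n m) (hn : 3 ≤ n)
    (hrow : ∀ b, 1 ≤ b → b < n → b ≠ 1 → b ≠ n - 1 → m 1 b = 0)
    (hcol : ∀ a, 1 ≤ a → a < n → a ≠ 1 → a ≠ n - 1 → m a 1 = 0) :
    (∀ b, 1 ≤ b → b < n → b ≠ 1 → m 1 b = 0) ∧ (∀ a, 1 ≤ a → a < n → a ≠ 1 → m a 1 = 0) ∨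
      IsSimpleCurrentExtension n m := by
  have s1 := sinPi_pos (n := n) (k := 1) le_rfl (by omega)
  have s2 := sinPi_pos (n := n) (k := 2) (by omega) (by omega)
  have hsum : ∀ b, 1 ≤ b → b < n → ∑ c ∈ Ico 1 n, sinPi n c * (m c b : ℝ)
      = (1 + m 1 (n - 1) * (-1) ^ (b + 1)) * sinPi n b := by
    intro b hb hb'
    have h1 := h.comm 1 b le_rfl (by omega) hb hb'
    rw [sum_label_eq_add (i := 1) (j := n - 1) (by omega) le_rfl (by omega) (by omega) (by omega)
      (fun k hk hk' hk1 hk2 => by simp [hrow k hk hk' hk1 hk2]), h.one_one,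
      sinPi_sub_mul (by omega) (by omega)] at h1
    simp only [one_mul, Nat.cast_one] at h1
    rw [← h1]
    ring
  have heq : m (n - 1) 1 = m 1 (n - 1) := by
    have h1 := hsum 1 le_rfl (by omega)
    rw [sum_label_eq_add (i := 1) (j := n - 1) (by omega) le_rfl (by omega) (by omega) (by omega)
      (fun k hk hk' hk1 hk2 => by simp [hcol k hk hk' hk1 hk2]), h.one_one,
      sinPi_sub (by omega) (by omega)] at h1
    have h2 : sinPi n 1 * ((m (n - 1) 1 : ℝ) - m 1 (n - 1)) = 0 := by
      norm_num at h1
      linear_combination h1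
    have h3 := (mul_eq_zero.1 h2).resolve_left s1.ne'
    exact_mod_cast sub_eq_zero.1 h3
  by_cases h0 : m 1 (n - 1) = 0
  · left
    refine ⟨fun b hb hb' hb1 => ?_, fun a ha ha' ha1 => ?_⟩
    · by_cases hbn : b = n - 1
      · rw [hbn, h0]
      · exact hrow b hb hb' hb1 hbn
    · by_cases han : a = n - 1
      · rw [han, heq, h0]
      · exact hcol a ha ha' ha1 han
  · right
    -- The `T` condition between `1` and `n - 1` needs `4 n ∣ (n - 1)² - 1 = n (n - 2)`.
    have h4 : n % 4 = 2 := by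
      have h1 := (h.sq_modEq 1 (n - 1) le_rfl (by omega) (by omega) (by omega) h0)
      rw [← Int.natCast_modEq_iff, Int.modEq_iff_dvd] at h1
      push_cast [Nat.cast_sub (by omega : 1 ≤ n)] at h1
      have h2 : ((n : ℤ) - 1) ^ 2 - 1 = n * (n - 2) := by ring
      rw [h2, mul_comm 4] at h1
      have h3 := Int.dvd_of_mul_dvd_mul_left (by omega : (n : ℤ) ≠ 0) h1
      omega
    -- Column `2` has the nonnegative weighted sum `(1 - m 1 (n - 1)) sin(2π/n)`.
    have h1 : m 1 (n - 1) = 1 := by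
      have h2 : 0 ≤ ∑ c ∈ Ico 1 n, sinPi n c * (m c 2 : ℝ) :=
        sum_nonneg fun c hc => mul_nonneg (sinPi_nonneg_of_mem hc) (Nat.cast_nonneg _)
      rw [hsum 2 (by omega) (by omega)] at h2
      have h3 : (m 1 (n - 1) : ℝ) ≤ 1 := by
        norm_num at h2
        nlinarith
      have h5 : m 1 (n - 1) ≤ 1 := by exact_mod_cast h3
      omega
    exact ⟨h, by omega, h4, h1, hrow, heq.trans h1, hcol⟩

theorem row_one_eq_zero (h : IsInvariantTable n m) (hn : 3 ≤ n) {b : ℕ} (hb : 1 ≤ b) (hb' : b < n)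
    (hb1 : ¬ (b = 1 ∨ b = n - 1 ∨ (n = 12 ∧ b = 7) ∨ (n = 30 ∧ (b = 11 ∨ b = 19)))) : m 1 b = 0 := by
  by_contra hne
  exact hb1 (h.row_one_support hn hb hb' hne)

theorem twelve_row_eleven (h : IsInvariantTable 12 m) : m 1 11 = 0 := by
  by_contra hne
  have := h.sq_modEq 1 11 (by norm_num) (by norm_num) (by norm_num) (by norm_num) hne
  norm_num [Nat.ModEq] at this

theorem twelve_row (h : IsInvariantTable 12 m) {b : ℕ} (hb : 1 ≤ b) (hb' : b < 12)
    (hb1 : b ∉ ({1, 7} : Finset ℕ)) : m 1 b = 0 := by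
  by_cases h11 : b = 11
  · rw [h11, h.twelve_row_eleven]
  · simp only [mem_insert, mem_singleton] at hb1
    exact h.row_one_eq_zero (by norm_num) hb hb' (by omega)

theorem twelve_col_sum (h : IsInvariantTable 12 m) {b : ℕ} (hb : 1 ≤ b) (hb' : b < 12) :
    ∑ c ∈ Ico 1 12, sinPi 12 c * (m c b : ℝ) = sinPi 12 b + m 1 7 * sinPi 12 (7 * b) := by
  have h1 := h.comm 1 b le_rfl (by norm_num) hb hb'
  rw [sum_label_of_subset {1, 7} (by decide)
    (fun k hk hk' hkt => by simp [h.twelve_row hk hk' hkt]), sum_pair (by norm_num), h.one_one] at h1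
  simp only [one_mul, Nat.cast_one] at h1
  exact h1.symm

theorem twelve_dichotomy (h : IsInvariantTable 12 m) :
    m 1 7 = m 7 1 ∧ (m 1 7 = 0 ∨ IsE6Extension m) := by
  have s2 := sinPi_pos (n := 12) (k := 2) (by norm_num) (by norm_num)
  have s7 := sinPi_pos (n := 12) (k := 7) (by norm_num) (by norm_num)
  have heq : m 1 7 = m 7 1 := by
    have h1 := h.twelve_col_sum (b := 1) (by norm_num) (by norm_num)
    rw [sum_label_of_subset {1, 7} (by decide)
      (fun k hk hk' hkt => by simp [h.transpose.twelve_row hk hk' hkt]), sum_pair (by norm_num),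
      h.one_one] at h1
    have h2 : sinPi 12 7 * ((m 1 7 : ℝ) - m 7 1) = 0 := by
      norm_num at h1
      linear_combination -h1
    have h3 := (mul_eq_zero.1 h2).resolve_left s7.ne'
    exact_mod_cast sub_eq_zero.1 h3
  refine ⟨heq, ?_⟩
  by_cases h0 : m 1 7 = 0
  · exact Or.inl h0
  · right
    have h1 : m 1 7 = 1 := by
      have h2 : 0 ≤ ∑ c ∈ Ico 1 12, sinPi 12 c * (m c 2 : ℝ) :=
        sum_nonneg fun c hc => mul_nonneg (sinPi_nonneg_of_mem hc) (Nat.cast_nonneg _)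
      have e14 : sinPi 12 14 = -sinPi 12 2 := by rw [sinPi_reduce (by norm_num)]; norm_num
      rw [h.twelve_col_sum (by norm_num) (by norm_num)] at h2
      norm_num only [e14] at h2
      have h3 : (m 1 7 : ℝ) ≤ 1 := by nlinarith
      have h5 : m 1 7 ≤ 1 := by exact_mod_cast h3
      omega
    exact ⟨h, h1, fun b hb hb' => h.twelve_row hb hb', heq ▸ h1,
      fun a ha ha' => h.transpose.twelve_row ha ha'⟩

theorem thirty_row (h : IsInvariantTable 30 m) {b : ℕ} (hb : 1 ≤ b) (hb' : b < 30)
    (hb1 : b ∉ ({1, 11, 19, 29} : Finset ℕ)) : m 1 b = 0 := by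
  simp only [mem_insert, mem_singleton] at hb1
  exact h.row_one_eq_zero (by norm_num) hb hb' (by omega)

theorem thirty_col_sum (h : IsInvariantTable 30 m) {b : ℕ} (hb : 1 ≤ b) (hb' : b < 30) :
    ∑ c ∈ Ico 1 30, sinPi 30 c * (m c b : ℝ) = sinPi 30 b + m 1 11 * sinPi 30 (11 * b)
      + m 1 19 * sinPi 30 (19 * b) + m 1 29 * sinPi 30 (29 * b) := by
  have h1 := h.comm 1 b le_rfl (by norm_num) hb hb'
  rw [sum_label_of_subset {1, 11, 19, 29} (by decide)
    (fun k hk hk' hkt => by simp [h.thirty_row hk hk' hkt]),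
    sum_four (by norm_num) (by norm_num) (by norm_num) (by norm_num) (by norm_num) (by norm_num),
    h.one_one] at h1
  simp only [one_mul, Nat.cast_one] at h1
  exact h1.symm

/-- The column sums are nonnegative. Columns `10`, `12` and `3` give three linear inequalities whose
natural-number solutions `(m 1 11, m 1 19, m 1 29)` are `000`, `001`, `111`, `100` and `010`.
Columns `4` and `2` exclude the last two. -/
theorem thirty_row_entries (h : IsInvariantTable 30 m) :
    (m 1 11 = 0 ∧ m 1 19 = 0 ∧ m 1 29 ≤ 1) ∨ (m 1 11 = 1 ∧ m 1 19 = 1 ∧ m 1 29 = 1) := by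
  have hnn : ∀ b, 1 ≤ b → b < 30 → 0 ≤ sinPi 30 b + m 1 11 * sinPi 30 (11 * b)
      + m 1 19 * sinPi 30 (19 * b) + m 1 29 * sinPi 30 (29 * b) := by
    intro b hb hb'
    rw [← h.thirty_col_sum hb hb']
    exact sum_nonneg fun c hc => mul_nonneg (sinPi_nonneg_of_mem hc) (Nat.cast_nonneg _)
  have s3 := sinPi_pos (n := 30) (k := 3) (by norm_num) (by norm_num)
  have s10 := sinPi_pos (n := 30) (k := 10) (by norm_num) (by norm_num)
  have s12 := sinPi_pos (n := 30) (k := 12) (by norm_num) (by norm_num)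
  have l4 := sinPi_lt_sinPi (n := 30) (a := 4) (b := 14) (by norm_num) (by norm_num)
  have l2 := sinPi_lt_sinPi (n := 30) (a := 2) (b := 8) (by norm_num) (by norm_num)
  have h10 := hnn 10 (by norm_num) (by norm_num)
  have h12 := hnn 12 (by norm_num) (by norm_num)
  have h3 := hnn 3 (by norm_num) (by norm_num)
  have h4 := hnn 4 (by norm_num) (by norm_num)
  have h2 := hnn 2 (by norm_num) (by norm_num)
  norm_num only at h10 h12 h3 h4 h2
  have e110 : sinPi 30 110 = -sinPi 30 10 := by rw [sinPi_reduce (by norm_num)]; norm_num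
  have e190 : sinPi 30 190 = sinPi 30 10 := by rw [sinPi_reduce (by norm_num)]; norm_num
  have e290 : sinPi 30 290 = -sinPi 30 10 := by rw [sinPi_reduce (by norm_num)]; norm_num
  have e132 : sinPi 30 132 = sinPi 30 12 := by rw [sinPi_reduce (by norm_num)]; norm_num
  have e228 : sinPi 30 228 = -sinPi 30 12 := by rw [sinPi_reduce (by norm_num)]; norm_num
  have e348 : sinPi 30 348 = -sinPi 30 12 := by rw [sinPi_reduce (by norm_num)]; norm_num
  have e33 : sinPi 30 33 = -sinPi 30 3 := by rw [sinPi_reduce (by norm_num)]; norm_num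
  have e57 : sinPi 30 57 = -sinPi 30 3 := by rw [sinPi_reduce (by norm_num)]; norm_num
  have e87 : sinPi 30 87 = sinPi 30 3 := by rw [sinPi_reduce (by norm_num)]; norm_num
  have e44 : sinPi 30 44 = -sinPi 30 14 := by rw [sinPi_reduce (by norm_num)]; norm_num
  have e38 : sinPi 30 38 = -sinPi 30 8 := by rw [sinPi_reduce (by norm_num)]; norm_num
  rw [e110, e190, e290] at h10
  rw [e132, e228, e348] at h12
  rw [e33, e57, e87] at h3
  rw [e44] at h4
  rw [e38] at h2
  have i10 : (0 : ℝ) ≤ 1 - m 1 11 + m 1 19 - m 1 29 := by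
    refine nonneg_of_mul_nonneg_left (b := sinPi 30 10) ?_ s10
    linarith
  have i12 : (0 : ℝ) ≤ 1 + m 1 11 - m 1 19 - m 1 29 := by
    refine nonneg_of_mul_nonneg_left (b := sinPi 30 12) ?_ s12
    linarith
  have i3 : (0 : ℝ) ≤ 1 - m 1 11 - m 1 19 + m 1 29 := by
    refine nonneg_of_mul_nonneg_left (b := sinPi 30 3) ?_ s3
    linarith
  have j10 : (0 : ℤ) ≤ 1 - m 1 11 + m 1 19 - m 1 29 := by exact_mod_cast i10
  have j12 : (0 : ℤ) ≤ 1 + m 1 11 - m 1 19 - m 1 29 := by exact_mod_cast i12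
  have j3 : (0 : ℤ) ≤ 1 - m 1 11 - m 1 19 + m 1 29 := by exact_mod_cast i3
  have k4 : ¬ (m 1 11 = 1 ∧ m 1 19 = 0 ∧ m 1 29 = 0) := by
    rintro ⟨p, q, r⟩
    rw [p, q, r] at h4
    norm_num at h4
    linarith
  have k2 : ¬ (m 1 11 = 0 ∧ m 1 19 = 1 ∧ m 1 29 = 0) := by
    rintro ⟨p, q, r⟩
    rw [p, q, r] at h2
    norm_num at h2
    linarith
  omega

/-- Commutation at `(1, 1)` equates the weighted sums of the first row and first column. As
`sin(11π/30) > sin(π/30)`, one cannot be of `E₈` type without the other. -/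
theorem thirty_dichotomy (h : IsInvariantTable 30 m) :
    (m 1 11 = 0 ∧ m 1 19 = 0 ∧ m 11 1 = 0 ∧ m 19 1 = 0) ∨ IsE8Extension m := by
  have s1 := sinPi_pos (n := 30) (k := 1) (by norm_num) (by norm_num)
  have l1 := sinPi_lt_sinPi (n := 30) (a := 1) (b := 11) (by norm_num) (by norm_num)
  have e19 : sinPi 30 19 = sinPi 30 11 := by rw [sinPi_reduce (by norm_num)]; norm_num
  have e29 : sinPi 30 29 = sinPi 30 1 := by rw [sinPi_reduce (by norm_num)]; norm_num
  have h1 := h.thirty_col_sum (b := 1) (by norm_num) (by norm_num)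
  have hrow := h.thirty_row_entries
  have hcol := h.transpose.thirty_row_entries
  rw [sum_label_of_subset {1, 11, 19, 29} (by decide)
    (fun k hk hk' hkt => by simp [h.transpose.thirty_row hk hk' hkt]),
    sum_four (by norm_num) (by norm_num) (by norm_num) (by norm_num) (by norm_num) (by norm_num),
    h.one_one] at h1
  norm_num only [e19, e29] at h1
  rcases hrow with ⟨p, q, r⟩ | ⟨p, q, r⟩ <;> rcases hcol with ⟨p', q', r'⟩ | ⟨p', q', r'⟩
  · exact Or.inl ⟨p, q, p', q'⟩
  · exfalso
    rw [p, q, p', q', r'] at h1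
    have : (m 1 29 : ℝ) ≤ 1 := by exact_mod_cast r
    norm_num at h1
    nlinarith
  · exfalso
    rw [p, q, r, p', q'] at h1
    have : (m 29 1 : ℝ) ≤ 1 := by exact_mod_cast r'
    norm_num at h1
    nlinarith
  · right
    refine ⟨h, ?_, fun b hb hb' => h.thirty_row hb hb', ?_,
      fun a ha ha' => h.transpose.thirty_row ha ha'⟩
    · simp [h.one_one, *]
    · simp [h.one_one, *]

/-- The classification of invariant tables. -/
theorem classification (h : IsInvariantTable n m) (hn : 3 ≤ n) :
    (∀ a b, 1 ≤ a → a < n → 1 ≤ b → b < n → m a b = if b = a then 1 else 0) ∨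
    (n % 4 = 0 ∧ ∀ a b, 1 ≤ a → a < n → 1 ≤ b → b < n →
      m a b = if b = (if a % 2 = 1 then a else n - a) then 1 else 0) ∨
    (n % 4 = 2 ∧ ∀ a b, 1 ≤ a → a < n → 1 ≤ b → b < n → m a b =
      if a % 2 = 1 ∧ b % 2 = 1 then (if a = b then 1 else 0) + (if a = n - b then 1 else 0)
      else 0) ∨
    (n = 12 ∧ ∀ a b, 1 ≤ a → a < n → 1 ≤ b → b < n → m a b = tableE6 a b) ∨
    (n = 18 ∧ ∀ a b, 1 ≤ a → a < n → 1 ≤ b → b < n → m a b = tableE7 a b) ∨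
    (n = 30 ∧ ∀ a b, 1 ≤ a → a < n → 1 ≤ b → b < n → m a b = tableE8 a b) := by
  have hexc : ((n = 12 → m 1 7 = 0 ∧ m 7 1 = 0) ∧
      (n = 30 → m 1 11 = 0 ∧ m 1 19 = 0 ∧ m 11 1 = 0 ∧ m 19 1 = 0)) ∨
      (n = 12 ∧ IsE6Extension m) ∨ (n = 30 ∧ IsE8Extension m) := by
    by_cases h12 : n = 12
    · subst h12
      obtain ⟨h1, h2 | h2⟩ := h.twelve_dichotomy
      · exact Or.inl ⟨fun _ => ⟨h2, h1 ▸ h2⟩, fun h => absurd h (by norm_num)⟩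
      · exact Or.inr (Or.inl ⟨rfl, h2⟩)
    · by_cases h30 : n = 30
      · subst h30
        rcases h.thirty_dichotomy with h1 | h1
        · exact Or.inl ⟨fun h => absurd h (by norm_num), fun _ => h1⟩
        · exact Or.inr (Or.inr ⟨rfl, h1⟩)
      · exact Or.inl ⟨fun h => absurd h h12, fun h => absurd h h30⟩
  rcases hexc with ⟨h12, h30⟩ | ⟨rfl, hE⟩ | ⟨rfl, hE⟩
  · have hrow : ∀ b, 1 ≤ b → b < n → b ≠ 1 → b ≠ n - 1 → m 1 b = 0 := by
      intro b hb hb' hb1 hbn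
      by_contra hne
      rcases h.row_one_support hn hb hb' hne with e | e | ⟨e, rfl⟩ | ⟨e, rfl | rfl⟩
      · exact hb1 e
      · exact hbn e
      · exact hne (h12 e).1
      · exact hne (h30 e).1
      · exact hne (h30 e).2.1
    have hcol : ∀ a, 1 ≤ a → a < n → a ≠ 1 → a ≠ n - 1 → m a 1 = 0 := by
      intro a ha ha' ha1 han
      by_contra hne
      rcases h.transpose.row_one_support hn ha ha' hne with e | e | ⟨e, rfl⟩ | ⟨e, rfl | rfl⟩
      · exact ha1 e
      · exact han e
      · exact hne (h12 e).2
      · exact hne (h30 e).2.2.1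
      · exact hne (h30 e).2.2.2
    rcases h.classification_of_support hn hrow hcol with ⟨h1, h2⟩ | hJ
    · rcases h.eq_of_trivial_row hn h1 h2 with h3 | h3
      · exact Or.inl h3
      · exact Or.inr (Or.inl h3)
    · rcases hJ.classification with h3 | ⟨rfl, h3⟩
      · exact Or.inr (Or.inr (Or.inl ⟨hJ.mod_four, h3⟩))
      · exact Or.inr (Or.inr (Or.inr (Or.inr (Or.inl ⟨rfl, h3⟩))))
  · exact Or.inr (Or.inr (Or.inr (Or.inl ⟨rfl, hE.eq_tableE6⟩)))
  · exact Or.inr (Or.inr (Or.inr (Or.inr (Or.inr ⟨rfl, hE.eq_tableE8⟩))))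

end IsInvariantTable

/-! ### The listed tables are invariant -/

theorem IsInvariantTable.congr {n : ℕ} {m m' : ℕ → ℕ → ℕ} (hn : 3 ≤ n) (h : IsInvariantTable n m)
    (hmm : ∀ a b, 1 ≤ a → a < n → 1 ≤ b → b < n → m' a b = m a b) : IsInvariantTable n m' where
  comm a b ha ha' hb hb' := by
    rw [sum_congr rfl fun c hc => by rw [hmm a c ha ha' (mem_Ico.1 hc).1 (mem_Ico.1 hc).2],
      h.comm a b ha ha' hb hb']
    exact sum_congr rfl fun c hc => by rw [hmm c b (mem_Ico.1 hc).1 (mem_Ico.1 hc).2 hb hb']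
  sq_modEq a b ha ha' hb hb' := by
    rw [hmm a b ha ha' hb hb']
    exact h.sq_modEq a b ha ha' hb hb'
  one_one := by rw [hmm 1 1 le_rfl (by omega) le_rfl (by omega), h.one_one]

theorem isInvariantTable_diag (n : ℕ) : IsInvariantTable n fun a b => if b = a then 1 else 0 where
  comm a b ha ha' hb hb' := by
    rw [sum_label_eq ha ha' fun k _ _ hka => by simp [hka],
      sum_label_eq hb hb' fun k _ _ hkb => by simp [hkb.symm]]
    simp
  sq_modEq a b _ _ _ _ hab := by
    have : b = a := by simpa using hab
    rw [this]
  one_one := by simp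

/-- Applying the permutation to either factor of `sin(πab/n)` changes its sign exactly when `a` and
`b` are both even. -/
theorem isInvariantTable_perm {n : ℕ} (hn : 3 ≤ n) (h4 : n % 4 = 0) :
    IsInvariantTable n fun a b => if b = (if a % 2 = 1 then a else n - a) then 1 else 0 where
  comm a b ha ha' hb hb' := by
    have hL : ∑ c ∈ Ico 1 n, (((if c = (if a % 2 = 1 then a else n - a) then 1 else 0 : ℕ)) : ℝ)
        * sinPi n (c * b) = sinPi n ((if a % 2 = 1 then a else n - a) * b) := by
      rw [sum_label_eq (i := if a % 2 = 1 then a else n - a) (by split_ifs <;> omega)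
        (by split_ifs <;> omega) fun k _ _ hk => by rw [if_neg hk]; simp]
      rw [if_pos rfl]
      simp
    have hR : ∑ c ∈ Ico 1 n, sinPi n (a * c)
        * (((if b = (if c % 2 = 1 then c else n - c) then 1 else 0 : ℕ)) : ℝ)
        = sinPi n (a * (if b % 2 = 1 then b else n - b)) := by
      rw [sum_label_eq (i := if b % 2 = 1 then b else n - b) (by split_ifs <;> omega)
        (by split_ifs <;> omega) fun k hk hk' hkb => ?_]
      · have hσ : b = if (if b % 2 = 1 then b else n - b) % 2 = 1 then
            (if b % 2 = 1 then b else n - b) else n - (if b % 2 = 1 then b else n - b) := by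
          by_cases hb2 : b % 2 = 1
          · simp [hb2]
          · rw [if_neg hb2, if_neg (by omega)]
            omega
        rw [← hσ, if_pos rfl]
        simp
      · rw [if_neg]
        · simp
        · intro h
          apply hkb
          split_ifs at h ⊢ <;> omega
    rw [hL, hR]
    split_ifs with h1 h2 h2
    · rfl
    · rw [sinPi_mul_sub (by omega) hb'.le, Even.neg_one_pow (by rw [Nat.even_iff]; omega), one_mul]
    · rw [sinPi_sub_mul (by omega) ha'.le, Even.neg_one_pow (by rw [Nat.even_iff]; omega), one_mul]
    · rw [sinPi_sub_mul (by omega) ha'.le, sinPi_mul_sub (by omega) hb'.le,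
        Odd.neg_one_pow (by rw [Nat.odd_iff]; omega), Odd.neg_one_pow (by rw [Nat.odd_iff]; omega)]
  sq_modEq a b ha ha' hb hb' hab := by
    have hba : b = if a % 2 = 1 then a else n - a := by
      by_contra hne
      exact hab (if_neg hne)
    split_ifs at hba with h1
    · rw [hba]
    · obtain ⟨k, hk⟩ : ∃ k, n = 4 * k := ⟨n / 4, by omega⟩
      obtain ⟨c, hc⟩ : ∃ c, a = 2 * c := ⟨a / 2, by omega⟩
      rw [← Int.natCast_modEq_iff, Int.modEq_iff_dvd, hba]
      push_cast [Nat.cast_sub ha'.le]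
      refine ⟨k - c, ?_⟩
      rw [hk, hc]
      push_cast
      ring
  one_one := by simp

/-- Both products equal `2 sin(πab/n)` when `a` and `b` are odd, and zero otherwise. -/
theorem isInvariantTable_fold {n : ℕ} (hn : 3 ≤ n) (h4 : n % 4 = 2) :
    IsInvariantTable n fun a b =>
      if a % 2 = 1 ∧ b % 2 = 1 then (if a = b then 1 else 0) + (if a = n - b then 1 else 0)
      else 0 where
  comm a b ha ha' hb hb' := by
    have hL : ∑ c ∈ Ico 1 n, (((if a % 2 = 1 ∧ c % 2 = 1 then
        (if a = c then 1 else 0) + (if a = n - c then 1 else 0) else 0 : ℕ)) : ℝ) * sinPi n (c * b)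
        = if a % 2 = 1 then sinPi n (a * b) + sinPi n ((n - a) * b) else 0 := by
      split_ifs with h1
      · have e : ∀ c ∈ Ico 1 n, (((if a % 2 = 1 ∧ c % 2 = 1 then
            (if a = c then 1 else 0) + (if a = n - c then 1 else 0) else 0 : ℕ)) : ℝ) * sinPi n (c * b)
            = (if c = a then sinPi n (a * b) else 0)
              + (if c = n - a then sinPi n ((n - a) * b) else 0) := by
          intro c hc
          have hc := mem_Ico.1 hc
          by_cases hca : c = a <;> by_cases hcn : c = n - a
          · rw [if_pos (by omega), if_pos hca.symm, if_pos (by omega), if_pos hca, if_pos hcn,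
              ← hcn, hca]
            push_cast; ring
          · rw [if_pos (by omega), if_pos hca.symm, if_neg (by omega), if_pos hca, if_neg hcn, hca]
            simp
          · rw [if_pos (by omega), if_neg (Ne.symm hca), if_pos (by omega), if_neg hca, if_pos hcn,
              hcn]
            simp
          · rw [if_neg (Ne.symm hca), if_neg (by omega : ¬ a = n - c), if_neg hca, if_neg hcn]
            simp
        rw [sum_congr rfl e, sum_add_distrib, sum_ite_eq', sum_ite_eq', if_pos (by simp [*]),
          if_pos (by rw [mem_Ico]; omega)]
      · exact sum_eq_zero fun c _ => by rw [if_neg (by tauto)]; simp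
    have hR : ∑ c ∈ Ico 1 n, sinPi n (a * c) * (((if c % 2 = 1 ∧ b % 2 = 1 then
        (if c = b then 1 else 0) + (if c = n - b then 1 else 0) else 0 : ℕ)) : ℝ)
        = if b % 2 = 1 then sinPi n (a * b) + sinPi n (a * (n - b)) else 0 := by
      split_ifs with h1
      · have e : ∀ c ∈ Ico 1 n, sinPi n (a * c) * (((if c % 2 = 1 ∧ b % 2 = 1 then
            (if c = b then 1 else 0) + (if c = n - b then 1 else 0) else 0 : ℕ)) : ℝ)
            = (if c = b then sinPi n (a * b) else 0)
              + (if c = n - b then sinPi n (a * (n - b)) else 0) := by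
          intro c hc
          have hc := mem_Ico.1 hc
          by_cases hcb : c = b <;> by_cases hcn : c = n - b
          · rw [if_pos (by omega), if_pos hcb, if_pos hcn, if_pos hcb, if_pos hcn, ← hcn, hcb]
            push_cast; ring
          · rw [if_pos (by omega), if_pos hcb, if_neg hcn, if_pos hcb, if_neg hcn, hcb]
            simp
          · rw [if_pos (by omega), if_neg hcb, if_pos hcn, if_neg hcb, if_pos hcn, hcn]
            simp
          · rw [if_neg hcb, if_neg hcn, if_neg hcb, if_neg hcn]
            simp
        rw [sum_congr rfl e, sum_add_distrib, sum_ite_eq', sum_ite_eq', if_pos (by simp [*]),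
          if_pos (by rw [mem_Ico]; omega)]
      · exact sum_eq_zero fun c _ => by rw [if_neg (by tauto)]; simp
    rw [hL, hR, sinPi_sub_mul (by omega) ha'.le, sinPi_mul_sub (by omega) hb'.le]
    rcases Nat.mod_two_eq_zero_or_one a with h1 | h1 <;>
      rcases Nat.mod_two_eq_zero_or_one b with h2 | h2 <;> simp only [h1, h2] <;> norm_num
    · rw [Odd.neg_one_pow (by rw [Nat.odd_iff]; omega)]
      simp
    · rw [Odd.neg_one_pow (by rw [Nat.odd_iff]; omega)]
      simp
    · rw [Even.neg_one_pow (by rw [Nat.even_iff]; omega),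
        Even.neg_one_pow (by rw [Nat.even_iff]; omega)]
      exact Or.inl rfl
  sq_modEq a b ha ha' hb hb' hab := by
    have h1 : a % 2 = 1 ∧ b % 2 = 1 ∧ (a = b ∨ a = n - b) := by
      by_contra hne
      apply hab
      split_ifs <;> first | rfl | (exfalso; tauto)
    obtain ⟨ha2, hb2, rfl | hba⟩ := h1
    · rfl
    · obtain ⟨k, hk⟩ : ∃ k, n = 4 * k + 2 := ⟨n / 4, by omega⟩
      obtain ⟨c, hc⟩ : ∃ c, b = 2 * c + 1 := ⟨b / 2, by omega⟩
      rw [← Int.natCast_modEq_iff, Int.modEq_iff_dvd, hba]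
      push_cast [Nat.cast_sub hb'.le]
      refine ⟨c - k, ?_⟩
      rw [hk, hc]
      push_cast
      ring
  one_one := by
    rw [if_pos (by norm_num), if_pos rfl, if_neg (by omega)]

/-- The indicator function of a set of labels. -/
noncomputable def labelIndicator (s : Finset ℕ) (a : ℕ) : ℝ := if a ∈ s then 1 else 0

theorem cast_blockTable (s t : Finset ℕ) (a b : ℕ) :
    (blockTable s t a b : ℝ) = labelIndicator s a * labelIndicator t b := by
  unfold blockTable labelIndicator
  by_cases h1 : a ∈ s <;> by_cases h2 : b ∈ t <;> simp [h1, h2]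

theorem sum_labelIndicator_mul {n : ℕ} {t : Finset ℕ} (ht : t ⊆ Ico 1 n) (f : ℕ → ℝ) :
    ∑ c ∈ Ico 1 n, labelIndicator t c * f c = ∑ c ∈ t, f c := by
  rw [sum_label_of_subset t ht fun k _ _ hk => by simp [labelIndicator, hk]]
  exact sum_congr rfl fun c hc => by simp [labelIndicator, hc]

theorem sum_blockTable_mul {n : ℕ} {s t : Finset ℕ} (ht : t ⊆ Ico 1 n) (a b : ℕ) :
    ∑ c ∈ Ico 1 n, (blockTable s t a c : ℝ) * sinPi n (c * b)
      = labelIndicator s a * ∑ c ∈ t, sinPi n (c * b) := by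
  rw [← sum_labelIndicator_mul ht, mul_sum]
  simp only [cast_blockTable, mul_assoc]

theorem sum_mul_blockTable {n : ℕ} {s t : Finset ℕ} (hs : s ⊆ Ico 1 n) (a b : ℕ) :
    ∑ c ∈ Ico 1 n, sinPi n (a * c) * (blockTable s t c b : ℝ)
      = labelIndicator t b * ∑ c ∈ s, sinPi n (c * a) := by
  rw [← sum_labelIndicator_mul hs, mul_sum]
  refine sum_congr rfl fun c _ => ?_
  rw [cast_blockTable, mul_comm a c]
  ring

/-- Sine sums over a block expand in the indicators of the blocks. The coefficient matrix of these
expansions is symmetric, which is commutation with `S`. -/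
theorem isInvariantTable_E6 : IsInvariantTable 12 tableE6 where
  comm a b ha ha' hb hb' := by
    have f1 : ∀ b, 1 ≤ b → b < 12 → ∑ c ∈ {1, 7}, sinPi 12 (c * b)
        = (sinPi 12 1 + sinPi 12 5) * labelIndicator {1, 7} b
          + 2 * sinPi 12 4 * labelIndicator {4, 8} b
          + (sinPi 12 1 + sinPi 12 5) * labelIndicator {5, 11} b := by
      intro b hb hb'
      rw [sum_pair (by norm_num), sinPi_reduce (by norm_num) (1 * b),
        sinPi_reduce (by norm_num) (7 * b)]
      interval_cases b <;> norm_num [labelIndicator] <;> ring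
    have f2 : ∀ b, 1 ≤ b → b < 12 → ∑ c ∈ {4, 8}, sinPi 12 (c * b)
        = 2 * sinPi 12 4 * labelIndicator {1, 7} b
          - 2 * sinPi 12 4 * labelIndicator {5, 11} b := by
      intro b hb hb'
      rw [sum_pair (by norm_num), sinPi_reduce (by norm_num) (4 * b),
        sinPi_reduce (by norm_num) (8 * b)]
      interval_cases b <;> norm_num [labelIndicator, sinPi_zero] <;> ring
    have f3 : ∀ b, 1 ≤ b → b < 12 → ∑ c ∈ {5, 11}, sinPi 12 (c * b)
        = (sinPi 12 1 + sinPi 12 5) * labelIndicator {1, 7} b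
          - 2 * sinPi 12 4 * labelIndicator {4, 8} b
          + (sinPi 12 1 + sinPi 12 5) * labelIndicator {5, 11} b := by
      intro b hb hb'
      rw [sum_pair (by norm_num), sinPi_reduce (by norm_num) (5 * b),
        sinPi_reduce (by norm_num) (11 * b)]
      interval_cases b <;> norm_num [labelIndicator] <;> ring
    unfold tableE6
    push_cast
    simp only [add_mul, mul_add, sum_add_distrib]
    rw [sum_blockTable_mul (by decide), sum_blockTable_mul (by decide),
      sum_blockTable_mul (by decide), sum_mul_blockTable (by decide),
      sum_mul_blockTable (by decide), sum_mul_blockTable (by decide),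
      f1 a ha ha', f1 b hb hb', f2 a ha ha', f2 b hb hb', f3 a ha ha', f3 b hb hb']
    ring
  sq_modEq a b ha ha' hb hb' hab := by
    have key : ∀ a ∈ range 12, ∀ b ∈ range 12, tableE6 a b ≠ 0 → a ^ 2 % 48 = b ^ 2 % 48 := by
      decide +kernel
    exact key a (mem_range.2 ha') b (mem_range.2 hb') hab
  one_one := by decide

/-- The expansion coefficients alone are not symmetric, because `{9}` is half the size of the other
blocks; they become so after multiplication by the matrix coupling `{9}` with `{3, 15}`. -/
theorem isInvariantTable_E7 : IsInvariantTable 18 tableE7 where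
  comm a b ha ha' hb hb' := by
    have s9 : sinPi 18 9 = 1 := sinPi_half (by norm_num) (by norm_num)
    have s3 : sinPi 18 3 = 1 / 2 := by
      unfold sinPi
      rw [← Real.sin_pi_div_six]
      congr 1
      push_cast
      ring
    have f1 : ∀ b, 1 ≤ b → b < 18 → ∑ c ∈ {1, 17}, sinPi 18 (c * b)
        = 2 * sinPi 18 1 * labelIndicator {1, 17} b + 2 * sinPi 18 5 * labelIndicator {5, 13} b
          + 2 * sinPi 18 7 * labelIndicator {7, 11} b + 2 * labelIndicator {9} b
          + labelIndicator {3, 15} b := by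
      intro b hb hb'
      rw [sum_pair (by norm_num), sinPi_reduce (by norm_num) (1 * b),
        sinPi_reduce (by norm_num) (17 * b)]
      interval_cases b <;> norm_num [labelIndicator, s3, s9] <;> ring
    have f2 : ∀ b, 1 ≤ b → b < 18 → ∑ c ∈ {5, 13}, sinPi 18 (c * b)
        = 2 * sinPi 18 5 * labelIndicator {1, 17} b - 2 * sinPi 18 7 * labelIndicator {5, 13} b
          - 2 * sinPi 18 1 * labelIndicator {7, 11} b + 2 * labelIndicator {9} b
          + labelIndicator {3, 15} b := by
      intro b hb hb'
      rw [sum_pair (by norm_num), sinPi_reduce (by norm_num) (5 * b),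
        sinPi_reduce (by norm_num) (13 * b)]
      interval_cases b <;> norm_num [labelIndicator, s3, s9] <;> ring
    have f3 : ∀ b, 1 ≤ b → b < 18 → ∑ c ∈ {7, 11}, sinPi 18 (c * b)
        = 2 * sinPi 18 7 * labelIndicator {1, 17} b - 2 * sinPi 18 1 * labelIndicator {5, 13} b
          + 2 * sinPi 18 5 * labelIndicator {7, 11} b - 2 * labelIndicator {9} b
          - labelIndicator {3, 15} b := by
      intro b hb hb'
      rw [sum_pair (by norm_num), sinPi_reduce (by norm_num) (7 * b),
        sinPi_reduce (by norm_num) (11 * b)]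
      interval_cases b <;> norm_num [labelIndicator, s3, s9] <;> ring
    have f4 : ∀ b, 1 ≤ b → b < 18 → ∑ c ∈ {9}, sinPi 18 (c * b)
        = labelIndicator {1, 17} b + labelIndicator {5, 13} b - labelIndicator {7, 11} b
          + labelIndicator {9} b - labelIndicator {3, 15} b := by
      intro b hb hb'
      rw [sum_singleton, sinPi_reduce (by norm_num) (9 * b)]
      interval_cases b <;> norm_num [labelIndicator, s3, s9, sinPi_zero]
    have f5 : ∀ b, 1 ≤ b → b < 18 → ∑ c ∈ {3, 15}, sinPi 18 (c * b)
        = labelIndicator {1, 17} b + labelIndicator {5, 13} b - labelIndicator {7, 11} b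
          - 2 * labelIndicator {9} b + 2 * labelIndicator {3, 15} b := by
      intro b hb hb'
      rw [sum_pair (by norm_num), sinPi_reduce (by norm_num) (3 * b),
        sinPi_reduce (by norm_num) (15 * b)]
      interval_cases b <;> norm_num [labelIndicator, s3, s9, sinPi_zero]
    unfold tableE7
    push_cast
    simp only [add_mul, mul_add, sum_add_distrib]
    rw [sum_blockTable_mul (by decide), sum_blockTable_mul (by decide),
      sum_blockTable_mul (by decide), sum_blockTable_mul (by decide),
      sum_blockTable_mul (by decide), sum_blockTable_mul (by decide),
      sum_mul_blockTable (by decide), sum_mul_blockTable (by decide),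
      sum_mul_blockTable (by decide), sum_mul_blockTable (by decide),
      sum_mul_blockTable (by decide), sum_mul_blockTable (by decide),
      f1 a ha ha', f1 b hb hb', f2 a ha ha', f2 b hb hb', f3 a ha ha', f3 b hb hb',
      f4 a ha ha', f4 b hb hb', f5 a ha ha', f5 b hb hb']
    ring
  sq_modEq a b ha ha' hb hb' hab := by
    have key : ∀ a ∈ range 18, ∀ b ∈ range 18, tableE7 a b ≠ 0 → a ^ 2 % 72 = b ^ 2 % 72 := by
      decide +kernel
    exact key a (mem_range.2 ha') b (mem_range.2 hb') hab
  one_one := by decide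

theorem isInvariantTable_E8 : IsInvariantTable 30 tableE8 where
  comm a b ha ha' hb hb' := by
    have f1 : ∀ b, 1 ≤ b → b < 30 → ∑ c ∈ {1, 11, 19, 29}, sinPi 30 (c * b)
        = 2 * (sinPi 30 1 + sinPi 30 11) * labelIndicator {1, 11, 19, 29} b
          + 2 * (sinPi 30 7 + sinPi 30 13) * labelIndicator {7, 13, 17, 23} b := by
      intro b hb hb'
      rw [sum_four (by norm_num) (by norm_num) (by norm_num) (by norm_num) (by norm_num)
        (by norm_num), sinPi_reduce (by norm_num) (1 * b), sinPi_reduce (by norm_num) (11 * b),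
        sinPi_reduce (by norm_num) (19 * b), sinPi_reduce (by norm_num) (29 * b)]
      interval_cases b <;> norm_num [labelIndicator] <;> ring
    have f2 : ∀ b, 1 ≤ b → b < 30 → ∑ c ∈ {7, 13, 17, 23}, sinPi 30 (c * b)
        = 2 * (sinPi 30 7 + sinPi 30 13) * labelIndicator {1, 11, 19, 29} b
          - 2 * (sinPi 30 1 + sinPi 30 11) * labelIndicator {7, 13, 17, 23} b := by
      intro b hb hb'
      rw [sum_four (by norm_num) (by norm_num) (by norm_num) (by norm_num) (by norm_num)
        (by norm_num), sinPi_reduce (by norm_num) (7 * b), sinPi_reduce (by norm_num) (13 * b),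
        sinPi_reduce (by norm_num) (17 * b), sinPi_reduce (by norm_num) (23 * b)]
      interval_cases b <;> norm_num [labelIndicator] <;> ring
    unfold tableE8
    push_cast
    simp only [add_mul, mul_add, sum_add_distrib]
    rw [sum_blockTable_mul (by decide), sum_blockTable_mul (by decide),
      sum_mul_blockTable (by decide), sum_mul_blockTable (by decide),
      f1 a ha ha', f1 b hb hb', f2 a ha ha', f2 b hb hb']
    ring
  sq_modEq a b ha ha' hb hb' hab := by
    have key : ∀ a ∈ range 30, ∀ b ∈ range 30, tableE8 a b ≠ 0 → a ^ 2 % 120 = b ^ 2 % 120 := by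
      decide +kernel
    exact key a (mem_range.2 ha') b (mem_range.2 hb') hab
  one_one := by decide

/-! ### From tables back to matrices -/

theorem eq_iff_toTable {n : ℕ} (M N : Matrix (Label n) (Label n) ℕ) :
    M = N ↔ ∀ a b, 1 ≤ a → a < n → 1 ≤ b → b < n → toTable M a b = toTable N a b := by
  constructor
  · rintro rfl a b - - - -
    rfl
  · intro h
    ext a b
    have ha := mem_Ico.1 a.2
    have hb := mem_Ico.1 b.2
    rw [← toTable_coe M, ← toTable_coe N, h a b ha.1 ha.2 hb.1 hb.2]

theorem toTable_apply {n : ℕ} (M : Matrix (Label n) (Label n) ℕ) {a b : ℕ} (ha : 1 ≤ a)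
    (ha' : a < n) (hb : 1 ≤ b) (hb' : b < n) :
    toTable M a b = M ⟨a, mem_Ico.2 ⟨ha, ha'⟩⟩ ⟨b, mem_Ico.2 ⟨hb, hb'⟩⟩ :=
  dif_pos ⟨mem_Ico.2 ⟨ha, ha'⟩, mem_Ico.2 ⟨hb, hb'⟩⟩

variable {n : ℕ} {a b : ℕ}

theorem toTable_invA (ha : 1 ≤ a) (ha' : a < n) (hb : 1 ≤ b) (hb' : b < n) :
    toTable (invA n) a b = if b = a then 1 else 0 := by
  rw [toTable_apply _ ha ha' hb hb', invA, Matrix.sum_apply,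
    sum_eq_single_of_mem a (mem_Ico.2 ⟨ha, ha'⟩) fun c _ hc => by
      simp [sqBlock, block, hc.symm]]
  simp [sqBlock, block]

theorem iterate_sub (ha : a ≤ n) (k : ℕ) :
    (fun c => n - c)^[k] a = if k % 2 = 0 then a else n - a := by
  induction k with
  | zero => rfl
  | succ k ih =>
    rw [Function.iterate_succ_apply', ih]
    split_ifs <;> omega

theorem toTable_invDPerm (ha : 1 ≤ a) (ha' : a < n) (hb : 1 ≤ b) (hb' : b < n) :
    toTable (invDPerm n) a b = if b = (if a % 2 = 1 then a else n - a) then 1 else 0 := by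
  rw [toTable_apply _ ha ha' hb hb', invDPerm, Matrix.sum_apply,
    sum_eq_single_of_mem a (mem_Ico.2 ⟨ha, ha'⟩) fun c _ hc => by simp [block, hc.symm]]
  have h1 : (if (a - 1) % 2 = 0 then a else n - a) = if a % 2 = 1 then a else n - a := by
    split_ifs <;> omega
  simp [block, iterate_sub ha'.le, h1]

theorem toTable_invDBlock (h4 : n % 4 = 2) (ha : 1 ≤ a) (ha' : a < n) (hb : 1 ≤ b) (hb' : b < n) :
    toTable (invDBlock n) a b =
      if a % 2 = 1 ∧ b % 2 = 1 then (if a = b then 1 else 0) + (if a = n - b then 1 else 0)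
      else 0 := by
  rw [toTable_apply _ ha ha' hb hb', invDBlock, Matrix.add_apply, Matrix.smul_apply,
    Matrix.sum_apply]
  simp only [sqBlock, block, Matrix.of_apply, mem_insert, mem_singleton]
  by_cases hab : a % 2 = 1 ∧ b % 2 = 1
  · rw [if_pos hab]
    by_cases haf : a = n / 2
    · rw [sum_eq_zero fun x hx => ?_]
      · by_cases hbf : b = n / 2
        · rw [if_pos ⟨haf, hbf⟩, if_pos (by omega), if_pos (by omega)]
          rfl
        · rw [if_neg (by tauto), if_neg (by omega), if_neg (by omega)]
          rfl
      · rw [mem_filter, mem_Ico] at hx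
        rw [if_neg (by omega)]
    -- Since `n` is even, `a` and `n - a` are both odd, and exactly one of them lies below `n / 2`
    -- and indexes the block of `a`.
    · rw [sum_eq_single_of_mem (if a < n / 2 then a else n - a)]
      · rw [if_neg (c := a = n / 2 ∧ b = n / 2) (by tauto)]
        split_ifs <;> first | rfl | (exfalso; omega)
      · rw [mem_filter, mem_Ico, Nat.odd_iff]
        split_ifs <;> omega
      · intro x hx hxa
        rw [mem_filter, mem_Ico] at hx
        rw [if_neg]
        rintro ⟨h1, -⟩
        apply hxa
        split_ifs <;> omega
  · rw [if_neg hab, if_neg (by omega), sum_eq_zero fun x hx => ?_]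
    · rfl
    · rw [mem_filter, mem_Ico, Nat.odd_iff] at hx
      rw [if_neg (by omega)]

theorem toTable_invE6 (ha : 1 ≤ a) (ha' : a < n) (hb : 1 ≤ b) (hb' : b < n) :
    toTable (invE6 n) a b = tableE6 a b := by
  rw [toTable_apply _ ha ha' hb hb']
  rfl

theorem toTable_invE7 (ha : 1 ≤ a) (ha' : a < n) (hb : 1 ≤ b) (hb' : b < n) :
    toTable (invE7 n) a b = tableE7 a b := by
  rw [toTable_apply _ ha ha' hb hb']
  rfl

theorem toTable_invE8 (ha : 1 ≤ a) (ha' : a < n) (hb : 1 ≤ b) (hb' : b < n) :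
    toTable (invE8 n) a b = tableE8 a b := by
  rw [toTable_apply _ ha ha' hb hb']
  rfl

end ADE

theorem mainTheorem1 (n : ℕ) (hn : 3 ≤ n) (M : Matrix (ADE.Label n) (ADE.Label n) ℕ) :
    ADE.IsPhysicalInvariant n hn M ↔
      M = ADE.invA n ∨
      (Even n ∧ Even (n / 2) ∧ M = ADE.invDPerm n) ∨
      (Even n ∧ Odd (n / 2) ∧ M = ADE.invDBlock n) ∨
      (n = 12 ∧ M = ADE.invE6 n) ∨
      (n = 18 ∧ M = ADE.invE7 n) ∨
      (n = 30 ∧ M = ADE.invE8 n) := by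
  rw [ADE.isPhysicalInvariant_iff]
  constructor
  · intro h
    simp only [ADE.eq_iff_toTable, Nat.even_iff, Nat.odd_iff]
    rcases h.classification hn with h1 | ⟨h4, h1⟩ | ⟨h4, h1⟩ | ⟨h4, h1⟩ | ⟨h4, h1⟩ | ⟨h4, h1⟩
    · left
      intro a b ha ha' hb hb'
      rw [h1 a b ha ha' hb hb', ADE.toTable_invA ha ha' hb hb']
    · right; left
      refine ⟨by omega, by omega, fun a b ha ha' hb hb' => ?_⟩
      rw [h1 a b ha ha' hb hb', ADE.toTable_invDPerm ha ha' hb hb']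
    · right; right; left
      refine ⟨by omega, by omega, fun a b ha ha' hb hb' => ?_⟩
      rw [h1 a b ha ha' hb hb', ADE.toTable_invDBlock h4 ha ha' hb hb']
    · right; right; right; left
      refine ⟨h4, fun a b ha ha' hb hb' => ?_⟩
      rw [h1 a b ha ha' hb hb', ADE.toTable_invE6 ha ha' hb hb']
    · right; right; right; right; left
      refine ⟨h4, fun a b ha ha' hb hb' => ?_⟩
      rw [h1 a b ha ha' hb hb', ADE.toTable_invE7 ha ha' hb hb']
    · right; right; right; right; right
      refine ⟨h4, fun a b ha ha' hb hb' => ?_⟩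
      rw [h1 a b ha ha' hb hb', ADE.toTable_invE8 ha ha' hb hb']
  · rintro (rfl | ⟨h2, h4, rfl⟩ | ⟨h2, h4, rfl⟩ | ⟨rfl, rfl⟩ | ⟨rfl, rfl⟩ | ⟨rfl, rfl⟩)
    · exact (ADE.isInvariantTable_diag n).congr hn fun a b => ADE.toTable_invA
    · rw [Nat.even_iff] at h2 h4
      exact (ADE.isInvariantTable_perm hn (by omega)).congr hn fun a b => ADE.toTable_invDPerm
    · rw [Nat.even_iff] at h2
      rw [Nat.odd_iff] at h4
      exact (ADE.isInvariantTable_fold hn (by omega)).congr hn fun a b =>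
        ADE.toTable_invDBlock (by omega)
    · exact ADE.isInvariantTable_E6.congr hn fun a b => ADE.toTable_invE6
    · exact ADE.isInvariantTable_E7.congr hn fun a b => ADE.toTable_invE7
    · exact ADE.isInvariantTable_E8.congr hn fun a b => ADE.toTable_invE8
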